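/- Let $k\ge 1$ and $m\ge k$ be integers and let $M\ge 0$. Let $A,B$ be elements of a complex unital Banach algebra with $\|1\|=1$ (for instance bounded operators on a nonzero Hilbert space) such that $\|A\|,\|B\|\le M$; let $0<\alpha\le 1$, let $H=A+\alpha B$, and let $\lambda\in\mathbb C$ with $|\lambda|\le 1$. Put $$S_2(\lambda)=e^{\lambda A/2}e^{\alpha\lambda B}e^{\lambda A/2},\qquad S_2^c(\lambda)=e^{C(\lambda)}S_2(\lambda)e^{-C(\lambda)},\qquad C(\lambda)=\alpha\sum_{j=1}^{m}\frac{B_{2j}(1/2)}{(2j)!}\,\lambda^{2j}\,\mathrm{ad}_A^{2j-1}(B),$$ where $B_n(x)$ are the Bernoulli polynomials and $\mathrm{ad}_A(X)=AX-XA$. For $l\ge 2$ define, by Suzuki's recursion with $p_l=1/(4-4^{1/(2l-1)})$, $$S^c_{2l}(\lambda)=\bigl[S^c_{2l-2}(p_l\lambda)\bigr]^2\,S^c_{2l-2}\bigl((1-4p_l)\lambda\bigr)\,\bigl[S^c_{2l-2}(p_l\lambda)\bigr]^2,$$ and define the standard product formulas $S_{2l}$ by the same recursion starting from $S_2$. Then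 there is a constant $K$ depending only on $k,m,M$ (not on the algebra, $A$, $B$, $\alpha$ or $\lambda$) such that $$\bigl\|e^{\lambda H}-S^c_{2k}(\lambda)\bigr\|\le K\bigl(\alpha^2|\lambda|^{2k+1}+\alpha|\lambda|^{2m+3}\bigr).$$ In particular the leading error is $\mathcal O(\alpha^2|\lambda|^{2k+1})$: whenever $|\lambda|^{2(m-k)+2}\le\alpha$ (that is, $|\lambda|^2\le\alpha$ for $m=k$), $$\bigl\|e^{\lambda H}-S^c_{2k}(\lambda)\bigr\|\le K\,\alpha^2|\lambda|^{2k+1},$$ which is a factor of $\alpha$ better than the bound for the standard product formula of order $2k$, $$\bigl\|e^{\lambda H}-S_{2k}(\lambda)\bigr\|\le K\,\alpha|\lambda|^{2k+1}.$$ -/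

import Mathlib

namespace CorrectedPF

noncomputable section

variable {𝔸 : Type*} [NormedRing 𝔸] [NormedAlgebra ℂ 𝔸]

/-- The coefficient `B_{2j}(1/2) / (2j)!`, with `B_n(x)` the Bernoulli polynomials. -/
def corrCoeff (j : ℕ) : ℚ :=
  (Polynomial.bernoulli (2 * j)).eval (1 / 2 : ℚ) / (Nat.factorial (2 * j) : ℚ)

/-- The commutator map `ad_A(X) = [A, X] = AX - XA`. -/
def adOp (A X : 𝔸) : 𝔸 := A * X - X * A

/-- The symplectic corrector of order `m`,
`C(m) = α ∑_{j=1}^m B_{2j}(1/2)/(2j)! z^{2j} ad_A^{2j-1}(B)`. -/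
def corrector (m : ℕ) (A B : 𝔸) (α : ℝ) (z : ℂ) : 𝔸 :=
  (α : ℂ) • ∑ j ∈ Finset.Icc 1 m,
    ((corrCoeff j : ℂ) * z ^ (2 * j)) • (adOp A)^[2 * j - 1] B

/-- The standard second-order formula `S₂(z) = e^{zA/2} e^{αzB} e^{zA/2}` for `A + αB`. -/
def pf2 (A B : 𝔸) (α : ℝ) (z : ℂ) : 𝔸 :=
  NormedSpace.exp ((z / 2) • A) * NormedSpace.exp (((α : ℂ) * z) • B) *
    NormedSpace.exp ((z / 2) • A)

/-- The corrected second-order formula `e^{C(m)} S₂(z) e^{-C(m)}`. -/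
def cpf2 (m : ℕ) (A B : 𝔸) (α : ℝ) (z : ℂ) : 𝔸 :=
  NormedSpace.exp (corrector m A B α z) * pf2 A B α z *
    NormedSpace.exp (-corrector m A B α z)

/-- Suzuki's parameter `p_k = 1 / (4 - 4^{1/(2k-1)})` (used for `k ≥ 2`). -/
def suzukiP (k : ℕ) : ℝ :=
  1 / (4 - (4 : ℝ) ^ (1 / (2 * (k : ℝ) - 1)))

/-- Suzuki's recursion. `suzuki S k` is the formula of order `2k` built from the second-order
formula `S = suzuki S 1`; the value at `k = 0` is a placeholder that is never used. -/
def suzuki (S : ℂ → 𝔸) : ℕ → ℂ → 𝔸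
  | 0 => fun _ => 1
  | 1 => S
  | k + 2 => fun z =>
      (suzuki S (k + 1) ((suzukiP (k + 2) : ℂ) * z)) ^ 2 *
        suzuki S (k + 1) ((1 - 4 * (suzukiP (k + 2) : ℂ)) * z) *
        (suzuki S (k + 1) ((suzukiP (k + 2) : ℂ) * z)) ^ 2

/-- The standard product formula of order `2k` for `A + αB`. -/
def pf (k : ℕ) (A B : 𝔸) (α : ℝ) : ℂ → 𝔸 :=
  suzuki (pf2 A B α) k

/-- The corrected product formula of order `2k` for `A + αB`, built from the second-order formula
corrected by `C(m)`. -/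
def cpf (m k : ℕ) (A B : 𝔸) (α : ℝ) : ℂ → 𝔸 :=
  suzuki (cpf2 m A B α) k

end

end CorrectedPF

/-! Absorb `α` into `B` and replace it by a complex parameter `t`. For fixed `z`, the error `f(t) =
S^c(z) - exp(z(A + tB))` is entire in `t`, and two independent estimates control it. First, for `|t|
≤ 2` it is `O(|z|^(2k+1))`, because Suzuki's recursion has order `2k` (`norm_cpf_sub_exp_le`).
Second, for `|t| ≤ 1` it is `O(|t| |z|^(2m+3) + |t|^2)` (`exists_norm_cpf_sub_exp_le`). The second
gives `f(0) = 0` and `f'(0) = O(|z|^(2m+3))`; the Schwarz lemma applied to `f(t) - t f'(0)`, bounded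
by means of the first since `m ≥ k`, makes the rest `O(|t|^2 |z|^(2k+1))` (`norm_le_of_linear_le`).

The second estimate is where the corrector acts. Let `F(x) = x / (2 sinh(x/2)) = ∑ B_n(1/2) x^n /
n!`. The part of `S₂^c` linear in `t` satisfies the linearised flow equation up to a residual `G(z
ad_A)(B) e^(zA)`, where `G = e^(x/2)(1 - x/2) - P - (e^x - 1) P'` and `P` is the truncation of `F`
used in the corrector. The full series `F` makes `G` vanish, so the truncation leaves `O(x^(2m+2))`,
and integration in `z` gains one more power. Stability of the recursion, which fixes `exp(zH)`,
carries the estimate from `S₂^c` to all orders.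

Uniformity of `K` over algebras comes from the Schwarz lemma: an order of vanishing, whose implied
constant is uncontrolled, becomes a bound depending only on a supremum over a disc of radius 2. -/

namespace CorrectedPF

open Asymptotics Filter Topology Metric

/-! ### Schwarz lemma and leading Taylor coefficients -/

section Analysis

variable {E : Type*} [NormedAddCommGroup E] [NormedSpace ℂ E]

/-- Schwarz lemma of higher order: an entire function bounded by `K` on the disc of radius `2` which
vanishes to order `n + 1` at the origin is bounded by `K ‖z‖ ^ (n + 1)` on the unit disc. -/
lemma norm_le_mul_pow_of_isLittleO {f : ℂ → E} (hf : Differentiable ℂ f) {K : ℝ} {n : ℕ}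
    (hK : ∀ z, ‖z‖ ≤ 2 → ‖f z‖ ≤ K) (h0 : f 0 = 0) (h : f =o[𝓝 0] fun z : ℂ => z ^ n) {z : ℂ}
    (hz : ‖z‖ ≤ 1) : ‖f z‖ ≤ K * ‖z‖ ^ (n + 1) := by
  have hK0 : 0 ≤ K := (norm_nonneg _).trans (hK 0 (by simp))
  have ho : (fun w => f w - f 0) =o[𝓝 0] fun w : ℂ => ‖w - 0‖ ^ n := by
    simpa only [h0, sub_zero, norm_pow] using h.norm_right
  have := Complex.dist_le_mul_div_pow_of_mapsTo_ball_of_isLittleO (f := f) (c := 0) (z := z)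
    (R₁ := 2) (R₂ := K) (n := n) hf.differentiableOn (fun w hw => by
      rw [h0, mem_closedBall_zero_iff]
      exact hK w (mem_ball_zero_iff.1 hw).le) ho (mem_ball_zero_iff.2 (by linarith))
  rw [h0, dist_zero_right, dist_zero_right] at this
  refine this.trans ?_
  gcongr
  linarith [norm_nonneg z]

/-- An analytic function which is `O(z ^ n)` has a leading coefficient of order `n`. -/
lemma exists_leading_coeff [CompleteSpace E] {f : ℂ → E} (hf : Differentiable ℂ f) {n : ℕ}
    (h : f =O[𝓝 0] fun z : ℂ => z ^ n) :
    ∃ e : E, (fun z => f z - z ^ n • e) =O[𝓝 0] fun z : ℂ => z ^ (n + 1) := by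
  obtain ⟨p, hp⟩ := hf.analyticAt 0
  have taylor (k : ℕ) : (fun z => f z - p.partialSum k z) =O[𝓝 0] fun z : ℂ => z ^ k := by
    have := hp.isBigO_sub_partialSum_pow k
    simp only [zero_add] at this
    exact (this.congr_right fun z => by rw [norm_pow]).of_norm_right
  -- All Taylor terms below the order of vanishing are zero: inductively the first surviving one is
  -- homogeneous of degree `k`, yet `O(z ^ (k + 1))`.
  have key (k : ℕ) (hk : f =O[𝓝 0] fun z : ℂ => z ^ k) (z : ℂ) : p.partialSum k z = 0 := by
    induction k generalizing z with
    | zero => simp [FormalMultilinearSeries.partialSum]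
    | succ k ih =>
      have ih := ih (hk.trans (isLittleO_pow_pow (Nat.lt_succ_self k)).isBigO)
      have h1 := hk.sub (taylor (k + 1))
      simp only [sub_sub_cancel] at h1
      have e (y : ℂ) : p.partialSum (k + 1) y = p k fun _ => y := by
        have := ih y
        simp only [FormalMultilinearSeries.partialSum] at this ⊢
        rw [Finset.sum_range_succ, this, zero_add]
      rw [e]
      refine IsBigO.continuousMultilinearMap_apply_eq_zero ?_ z
      refine (h1.norm_right.congr_left e).congr_right fun z => by rw [norm_pow]
  refine ⟨p.coeff n, (taylor (n + 1)).congr_left fun z => ?_⟩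
  have := key n h z
  simp only [FormalMultilinearSeries.partialSum] at this ⊢
  rw [Finset.sum_range_succ, this, zero_add, FormalMultilinearSeries.apply_eq_pow_smul_coeff]

lemma eq_zero_of_pow_smul_isBigO {e : E} {n : ℕ}
    (h : (fun z : ℂ => z ^ n • e) =O[𝓝 0] fun z : ℂ => z ^ (n + 1)) : e = 0 := by
  have h1 : (fun z : ℂ => z ^ n • e) =o[𝓝 0] fun z : ℂ => z ^ n :=
    h.trans_isLittleO (isLittleO_pow_pow (Nat.lt_succ_self n))
  by_contra he
  have h2 := h1.bound (c := ‖e‖ / 2) (by positivity)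
  have h3 : ∀ᶠ z : ℂ in 𝓝[≠] 0, False := by
    filter_upwards [h2.filter_mono nhdsWithin_le_nhds, self_mem_nhdsWithin] with z hz hz0
    rw [norm_smul] at hz
    have : 0 < ‖z ^ n‖ := norm_pos_iff.2 (pow_ne_zero _ hz0)
    have := norm_pos_iff.2 he
    nlinarith
  exact h3.exists.elim fun _ h => h

end Analysis

/-! ### Exponentials in a Banach algebra -/

section Exp

variable {𝔸 : Type*} [NormedRing 𝔸] [NormedAlgebra ℂ 𝔸] [CompleteSpace 𝔸]

lemma differentiable_exp : Differentiable ℂ (NormedSpace.exp : 𝔸 → 𝔸) := fun x =>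
  (NormedSpace.exp_analytic x).differentiableAt

lemma exp_mul_exp_neg (x : 𝔸) : NormedSpace.exp x * NormedSpace.exp (-x) = 1 := by
  let : NormedAlgebra ℚ 𝔸 := NormedAlgebra.restrictScalars ℚ ℂ 𝔸
  rw [← NormedSpace.exp_add_of_commute (Commute.refl x).neg_right, add_neg_cancel,
    NormedSpace.exp_zero]

lemma exp_neg_mul_exp (x : 𝔸) : NormedSpace.exp (-x) * NormedSpace.exp x = 1 := by
  simpa using exp_mul_exp_neg (-x)

lemma exp_smul_mul_exp_smul (x : 𝔸) (a b : ℂ) :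
    NormedSpace.exp (a • x) * NormedSpace.exp (b • x) = NormedSpace.exp ((a + b) • x) := by
  let : NormedAlgebra ℚ 𝔸 := NormedAlgebra.restrictScalars ℚ ℂ 𝔸
  rw [← NormedSpace.exp_add_of_commute (((Commute.refl x).smul_left a).smul_right b), add_smul]

/-- Taylor's formula for the exponential in a Banach algebra, with a bound for the remainder. -/
lemma exists_exp_eq_add_pow_mul [NormOneClass 𝔸] (N : ℕ) (x : 𝔸) :
    ∃ y : 𝔸, ‖y‖ ≤ Real.exp ‖x‖ ∧ NormedSpace.exp x =
      (∑ i ∈ Finset.range N, ((Nat.factorial i : ℂ)⁻¹) • x ^ i) + x ^ N * y := by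
  have hs : Summable fun n : ℕ => ‖((Nat.factorial n : ℂ)⁻¹) • x ^ n‖ :=
    NormedSpace.norm_expSeries_summable' x
  have hR : HasSum (fun n : ℕ => ‖x‖ ^ n / Nat.factorial n) (Real.exp ‖x‖) := by
    rw [Real.exp_eq_exp_ℝ]
    exact NormedSpace.expSeries_div_hasSum_exp ‖x‖
  have hle (n : ℕ) : ‖((Nat.factorial (n + N) : ℂ)⁻¹) • x ^ n‖ ≤ ‖x‖ ^ n / Nat.factorial n := by
    rw [norm_smul, norm_inv, Complex.norm_natCast, div_eq_inv_mul]
    gcongr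
    · exact Nat.le_add_right n N
    · exact norm_pow_le x n
  have hy : Summable fun n : ℕ => ((Nat.factorial (n + N) : ℂ)⁻¹) • x ^ n :=
    (Summable.of_nonneg_of_le (fun _ => norm_nonneg _) hle hR.summable).of_norm
  -- The tail of the series with `x ^ N` factored out; `n! ≤ (n + N)!` dominates it by the series of
  -- `exp ‖x‖`.
  refine ⟨∑' n : ℕ, ((Nat.factorial (n + N) : ℂ)⁻¹) • x ^ n, ?_, ?_⟩
  · exact tsum_of_norm_bounded hR hle
  · rw [NormedSpace.exp_eq_tsum ℂ, ← hy.tsum_mul_left]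
    beta_reduce
    rw [← hs.of_norm.sum_add_tsum_nat_add N]
    congr 1
    refine tsum_congr fun n => ?_
    rw [mul_smul_comm, ← pow_add, add_comm N n]

lemma norm_exp_le [NormOneClass 𝔸] (x : 𝔸) : ‖NormedSpace.exp x‖ ≤ Real.exp ‖x‖ := by
  obtain ⟨y, hy, h⟩ := exists_exp_eq_add_pow_mul 0 x
  rw [h]
  simpa using hy

lemma norm_exp_le_of_le [NormOneClass 𝔸] {x : 𝔸} {r : ℝ} (h : ‖x‖ ≤ r) :
    ‖NormedSpace.exp x‖ ≤ Real.exp r :=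
  (norm_exp_le x).trans (Real.exp_le_exp.2 h)

end Exp

end CorrectedPF

namespace CorrectedPF

open Polynomial

/-! ### The generating series of `B_n(1/2)` and its truncation -/

noncomputable section

/-- The coefficients `B_n(1/2) / n!`. -/
def bernoulliHalf (n : ℕ) : ℂ :=
  aeval (1 / 2 : ℂ) ((1 / Nat.factorial n : ℚ) • Polynomial.bernoulli n)

lemma bernoulliHalf_two_mul (j : ℕ) : bernoulliHalf (2 * j) = (corrCoeff j : ℂ) := by
  have h : (1 / 2 : ℂ) = algebraMap ℚ ℂ (1 / 2) := by simp
  rw [bernoulliHalf, corrCoeff, map_smul, h, aeval_algebraMap_apply, aeval_def,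
    Algebra.algebraMap_self, eval₂_id]
  rw [Rat.smul_def, div_eq_inv_mul]
  simp [div_eq_inv_mul]

/-- The reflection `B_n(1 - x) = (-1)^n B_n(x)` fixes `x = 1/2`. Hence the even terms kept by the
corrector are all there are. -/
lemma bernoulliHalf_odd (j : ℕ) : bernoulliHalf (2 * j + 1) = 0 := by
  have h : (1 / 2 : ℂ) = algebraMap ℚ ℂ (1 / 2) := by simp
  have h0 : (Polynomial.bernoulli (2 * j + 1)).eval (1 / 2 : ℚ) = 0 := by
    have := Polynomial.bernoulli_eval_one_sub (2 * j + 1) (1 / 2)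
    rw [pow_succ, pow_mul] at this
    norm_num at this ⊢
    linarith
  rw [bernoulliHalf, map_smul, h, aeval_algebraMap_apply, aeval_def,
    Algebra.algebraMap_self, eval₂_id, h0]
  simp

lemma bernoulliHalf_zero : bernoulliHalf 0 = 1 := by
  simp [bernoulliHalf]

/-- `e^{X/2}` as a power series. -/
def expHalf : PowerSeries ℂ := PowerSeries.rescale (1 / 2 : ℂ) (PowerSeries.exp ℂ)

lemma derivative_expHalf :
    PowerSeries.derivative ℂ expHalf = PowerSeries.C (1 / 2 : ℂ) * expHalf := by
  ext n
  simp only [expHalf, PowerSeries.coeff_derivative,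
    PowerSeries.coeff_rescale, PowerSeries.coeff_exp, PowerSeries.coeff_C_mul,
    Nat.factorial_succ]
  have : ((n : ℂ) + 1) ≠ 0 := by exact_mod_cast Nat.succ_ne_zero n
  have : ((Nat.factorial n : ℂ)) ≠ 0 := by exact_mod_cast Nat.factorial_ne_zero n
  simp
  field_simp
  ring

/-- The differential equation satisfied by `x / (2 sinh (x/2)) = ∑ B_n(1/2) x^n / n!`. -/
lemma bernoulliHalf_ode :
    expHalf * (1 - PowerSeries.C (1 / 2 : ℂ) * PowerSeries.X) - PowerSeries.mk bernoulliHalf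
      - (PowerSeries.exp ℂ - 1) * PowerSeries.derivative ℂ (PowerSeries.mk bernoulliHalf) = 0 := by
  have h : PowerSeries.mk bernoulliHalf * (PowerSeries.exp ℂ - 1) = PowerSeries.X * expHalf :=
    Polynomial.bernoulli_generating_function (1 / 2 : ℂ)
  -- Differentiate `F (e^X - 1) = X e^(X/2)`, then use the same identity to eliminate `F e^X`.
  have hd := congrArg (PowerSeries.derivative ℂ) h
  have he : PowerSeries.derivative ℂ (PowerSeries.exp ℂ) = PowerSeries.exp ℂ := by
    ext n
    simp [PowerSeries.coeff_derivative, PowerSeries.coeff_exp,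
      Nat.factorial_succ]
    have : ((n : ℂ) + 1) ≠ 0 := by exact_mod_cast Nat.succ_ne_zero n
    field_simp
  simp only [Derivation.leibniz, map_sub, he, derivative_expHalf, smul_eq_mul,
    Derivation.map_one_eq_zero, PowerSeries.derivative_X] at hd
  have hC : (PowerSeries.C (1 / 2 : ℂ)) * 2 = 1 := by
    rw [show (2 : PowerSeries ℂ) = PowerSeries.C 2 from rfl, ← map_mul]; simp
  linear_combination h - hd - PowerSeries.X * expHalf * hC

/-- The even truncation `∑_{j ≤ m} B_{2j}(1/2) / (2j)! X^{2j}`. -/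
def bernoulliPoly (m : ℕ) : ℂ[X] :=
  ∑ j ∈ Finset.range (m + 1), C (corrCoeff j : ℂ) * X ^ (2 * j)

/-- Agreement extends one degree past the top term `2m`, because the coefficient of degree `2m + 1`
vanishes on both sides. -/
lemma coeff_bernoulliPoly (m : ℕ) {d : ℕ} (hd : d < 2 * m + 2) :
    (bernoulliPoly m).coeff d = bernoulliHalf d := by
  simp only [bernoulliPoly, finsetSum_coeff, coeff_C_mul_X_pow]
  rcases Nat.even_or_odd' d with ⟨j, rfl | rfl⟩
  · rw [Finset.sum_eq_single j]
    · simp [bernoulliHalf_two_mul]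
    · intro b _ hb; rw [if_neg]; omega
    · intro h; simp at h; omega
  · rw [bernoulliHalf_odd]
    refine Finset.sum_eq_zero fun b _ => if_neg (by omega)

/-- The truncated exponential `∑_{i < N} (c X)^i / i!`. -/
def expPoly (N : ℕ) (c : ℂ) : ℂ[X] :=
  ∑ i ∈ Finset.range N, C ((Nat.factorial i : ℂ)⁻¹) * (C c * X) ^ i

lemma X_pow_dvd_expPoly_sub (N : ℕ) (c : ℂ) : (PowerSeries.X : PowerSeries ℂ) ^ N ∣
    (expPoly N c : PowerSeries ℂ) - PowerSeries.rescale c (PowerSeries.exp ℂ) := by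
  rw [PowerSeries.X_pow_dvd_iff]
  intro d hd
  simp only [map_sub, Polynomial.coeff_coe, PowerSeries.coeff_rescale, PowerSeries.coeff_exp,
    expPoly, mul_pow, ← C_pow, ← mul_assoc, ← C_mul, finsetSum_coeff, coeff_C_mul_X_pow]
  rw [Finset.sum_eq_single d]
  · simp [mul_comm]
  · intro b _ hb; rw [if_neg hb.symm]
  · intro h; simp at h; omega

/-- Replacing each series in `bernoulliHalf_ode` by its truncation changes it by multiples of `X ^
(2m+2)`. Differentiating the truncation error loses one power of `X`, which the factor `e^X - 1`
restores. -/
lemma X_pow_dvd_residual (m : ℕ) : (X : ℂ[X]) ^ (2 * m + 2) ∣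
    expPoly (2 * m + 2) (1 / 2) * (1 - C (1 / 2) * X) - bernoulliPoly m
      - (expPoly (2 * m + 2) 1 - 1) * derivative (bernoulliPoly m) := by
  rw [X_pow_dvd_iff]
  suffices h : (PowerSeries.X : PowerSeries ℂ) ^ (2 * m + 2) ∣
      ((expPoly (2 * m + 2) (1 / 2) * (1 - C (1 / 2) * X) - bernoulliPoly m
      - (expPoly (2 * m + 2) 1 - 1) * derivative (bernoulliPoly m) : ℂ[X]) : PowerSeries ℂ) by
    rw [PowerSeries.X_pow_dvd_iff] at h
    intro d hd
    simpa only [Polynomial.coeff_coe] using h d hd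
  obtain ⟨u, hu⟩ := X_pow_dvd_expPoly_sub (2 * m + 2) (1 / 2)
  obtain ⟨v, hv⟩ := X_pow_dvd_expPoly_sub (2 * m + 2) 1
  obtain ⟨w, hw⟩ : (PowerSeries.X : PowerSeries ℂ) ^ (2 * m + 2) ∣
      (bernoulliPoly m : PowerSeries ℂ) - PowerSeries.mk bernoulliHalf := by
    rw [PowerSeries.X_pow_dvd_iff]
    intro d hd
    simp [coeff_bernoulliPoly m hd]
  obtain ⟨r, hr⟩ : (PowerSeries.X : PowerSeries ℂ) ∣ PowerSeries.exp ℂ - 1 := by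
    rw [PowerSeries.X_dvd_iff]; simp
  have hd : (derivative (bernoulliPoly m) : PowerSeries ℂ) =
      PowerSeries.derivative ℂ (bernoulliPoly m : PowerSeries ℂ) := by
    rw [PowerSeries.derivative_coe]
  have hP := eq_add_of_sub_eq hw
  have hD : (derivative (bernoulliPoly m) : PowerSeries ℂ) =
      PowerSeries.derivative ℂ (PowerSeries.mk bernoulliHalf) + PowerSeries.X ^ (2 * m + 2) *
        PowerSeries.derivative ℂ w + (2 * (m : PowerSeries ℂ) + 2) * PowerSeries.X ^ (2 * m + 1) * w := by
    rw [hd, hP, map_add, Derivation.leibniz, Derivation.leibniz_pow]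
    simp only [smul_eq_mul, PowerSeries.derivative_X, nsmul_eq_mul]
    push_cast
    ring_nf
  rw [PowerSeries.rescale_one, RingHom.id_apply] at hv
  simp only [Polynomial.coe_sub, Polynomial.coe_mul, Polynomial.coe_one, Polynomial.coe_C,
    Polynomial.coe_X]
  rw [hP, eq_add_of_sub_eq hu, eq_add_of_sub_eq hv]
  have hode := bernoulliHalf_ode
  rw [expHalf] at hode
  refine ⟨u * (1 - PowerSeries.C (1 / 2) * PowerSeries.X) - w
    - v * (derivative (bernoulliPoly m) : PowerSeries ℂ)
    - (PowerSeries.exp ℂ - 1) * PowerSeries.derivative ℂ w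
    - (2 * (m : PowerSeries ℂ) + 2) * r * w, ?_⟩
  rw [hD]
  linear_combination hode - (2 * (m : PowerSeries ℂ) + 2) * PowerSeries.X ^ (2 * m + 1) * w * hr

variable {𝔸 : Type*} [NormedRing 𝔸] [NormedAlgebra ℂ 𝔸]

lemma norm_aeval_le [NormOneClass 𝔸] (p : ℂ[X]) {x : 𝔸} {R : ℝ} (hx : ‖x‖ ≤ R) :
    ‖aeval x p‖ ≤ ∑ i ∈ Finset.range (p.natDegree + 1), ‖p.coeff i‖ * R ^ i := by
  rw [aeval_eq_sum_range]
  refine norm_sum_le_of_le _ fun i _ => (norm_smul_le _ _).trans ?_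
  gcongr
  exact (norm_pow_le x i).trans (by gcongr)

lemma exists_exp_smul_eq [CompleteSpace 𝔸] [NormOneClass 𝔸] (N : ℕ) (c : ℂ) (x : 𝔸) :
    ∃ y : 𝔸, ‖y‖ ≤ ‖c‖ ^ N * Real.exp (‖c‖ * ‖x‖) ∧
      NormedSpace.exp (c • x) = aeval x (expPoly N c) + x ^ N * y := by
  obtain ⟨y, hy, h⟩ := exists_exp_eq_add_pow_mul N (c • x)
  refine ⟨c ^ N • y, ?_, ?_⟩
  · rw [norm_smul, norm_pow]
    gcongr
    rwa [norm_smul] at hy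
  · rw [h, expPoly, map_sum, _root_.smul_pow, smul_mul_assoc, mul_smul_comm]
    congr 1
    refine Finset.sum_congr rfl fun i _ => ?_
    simp [Algebra.algebraMap_eq_smul_one]

/-- The residual of the truncated corrector, evaluated in a Banach algebra. -/
lemma exists_norm_residual_le (m : ℕ) (R : ℝ) : ∃ K : ℝ, 0 ≤ K ∧
    ∀ (𝔸 : Type*) [NormedRing 𝔸] [NormOneClass 𝔸] [NormedAlgebra ℂ 𝔸] [CompleteSpace 𝔸] (x : 𝔸),
      ‖x‖ ≤ R → ‖NormedSpace.exp ((1 / 2 : ℂ) • x) * (1 - (1 / 2 : ℂ) • x)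
        - aeval x (bernoulliPoly m)
        - (NormedSpace.exp x - 1) * aeval x (derivative (bernoulliPoly m))‖
          ≤ K * ‖x‖ ^ (2 * m + 2) := by
  obtain ⟨q, hq⟩ := X_pow_dvd_residual m
  let b (p : ℂ[X]) : ℝ := ∑ i ∈ Finset.range (p.natDegree + 1), ‖p.coeff i‖ * |R| ^ i
  have hb (p : ℂ[X]) : 0 ≤ b p := Finset.sum_nonneg fun i _ => by positivity
  refine ⟨b q + Real.exp |R| * (1 + |R|) + Real.exp |R| * b (derivative (bernoulliPoly m)),
    by have := hb q; have := hb (derivative (bernoulliPoly m)); positivity, ?_⟩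
  intro 𝔸 _ _ _ _ x hx
  replace hx : ‖x‖ ≤ |R| := hx.trans (le_abs_self R)
  obtain ⟨y, hy, hey⟩ := exists_exp_smul_eq (2 * m + 2) (1 / 2) x
  obtain ⟨y', hy', hey'⟩ := exists_exp_smul_eq (2 * m + 2) 1 x
  have hq' := congrArg (aeval x) hq
  simp only [map_sub, map_mul, map_one, aeval_X, aeval_C, map_pow,
    Algebra.algebraMap_eq_smul_one, smul_mul_assoc, one_mul] at hq'
  have hyR : ‖y‖ ≤ Real.exp |R| := by
    refine hy.trans ?_
    calc ‖(1 / 2 : ℂ)‖ ^ (2 * m + 2) * Real.exp (‖(1 / 2 : ℂ)‖ * ‖x‖)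
        ≤ 1 * Real.exp |R| := by
          gcongr
          · exact pow_le_one₀ (norm_nonneg _) (by norm_num)
          · norm_num; linarith [norm_nonneg x]
      _ = _ := one_mul _
  have hyR' : ‖y'‖ ≤ Real.exp |R| := by
    refine hy'.trans ?_
    simpa using hx
  rw [one_smul] at hey'
  have e : NormedSpace.exp ((1 / 2 : ℂ) • x) * (1 - (1 / 2 : ℂ) • x)
        - aeval x (bernoulliPoly m)
        - (NormedSpace.exp x - 1) * aeval x (derivative (bernoulliPoly m)) =
      x ^ (2 * m + 2) * (aeval x q + y * (1 - (1 / 2 : ℂ) • x)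
        - y' * aeval x (derivative (bernoulliPoly m))) := by
    rw [add_sub_assoc, mul_add, ← hq', hey, hey']
    generalize (1 : 𝔸) - (1 / 2 : ℂ) • x = t
    noncomm_ring
  rw [e, mul_comm (_ + _ + _)]
  refine (norm_mul_le _ _).trans ?_
  gcongr
  · exact norm_pow_le x _
  · refine (norm_sub_le _ _).trans (add_le_add ((norm_add_le _ _).trans
      (add_le_add (norm_aeval_le q hx) ?_)) ?_)
    · refine (norm_mul_le _ _).trans ?_
      gcongr
      refine (norm_sub_le _ _).trans ?_
      rw [norm_one, norm_smul]
      norm_num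
      linarith [norm_nonneg x]
    · refine (norm_mul_le _ _).trans ?_
      gcongr
      exact norm_aeval_le _ hx

end

end CorrectedPF

namespace CorrectedPF

open Asymptotics Filter Topology

/-! ### Suzuki's parameter -/

section SuzukiParameter

/-- With `s = 4^(1/(2k+3))` and `p = 1/(4 - s)` one has `1 - 4p = -s p`, whose power `2k+3` is `-4
p^(2k+3)`. Since `s ≤ 2`, both dilation factors keep arguments inside a given disc. -/
lemma suzukiP_spec (k : ℕ) : |suzukiP (k + 2)| ≤ 1 ∧ |1 - 4 * suzukiP (k + 2)| ≤ 1 ∧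
    4 * suzukiP (k + 2) ^ (2 * k + 3) + (1 - 4 * suzukiP (k + 2)) ^ (2 * k + 3) = 0 := by
  have he : 2 * ((k + 2 : ℕ) : ℝ) - 1 = ((2 * k + 3 : ℕ) : ℝ) := by push_cast; ring
  obtain ⟨s, hs⟩ : ∃ s : ℝ, s = (4 : ℝ) ^ (1 / (2 * ((k + 2 : ℕ) : ℝ) - 1)) := ⟨_, rfl⟩
  have hp : suzukiP (k + 2) = 1 / (4 - s) := by rw [hs, suzukiP]
  rw [he, one_div] at hs
  have hs0 : 0 < s := hs ▸ Real.rpow_pos_of_pos (by norm_num) _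
  have hpow : s ^ (2 * k + 3) = 4 := by
    rw [hs, Real.rpow_inv_natCast_pow (by norm_num) (by omega)]
  have hs2 : s ≤ 2 := by
    by_contra! h
    have : (2 : ℝ) ^ (2 * k + 3) < s ^ (2 * k + 3) := pow_lt_pow_left₀ h (by norm_num) (by omega)
    have h2 : (2 : ℝ) ^ 2 ≤ 2 ^ (2 * k + 3) := pow_le_pow_right₀ (by norm_num) (by omega)
    rw [hpow] at this
    linarith
  have h4 : 0 < 4 - s := by linarith
  have hq : 1 - 4 * suzukiP (k + 2) = -(s * suzukiP (k + 2)) := by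
    rw [hp]; field_simp; ring
  have hp0 : 0 < suzukiP (k + 2) := by rw [hp]; positivity
  have hp1 : suzukiP (k + 2) ≤ 1 / 2 := by
    rw [hp]; exact one_div_le_one_div_of_le (by norm_num) (by linarith)
  refine ⟨by rw [abs_of_pos hp0]; linarith, ?_, ?_⟩
  · rw [hq, abs_neg, abs_of_pos (by positivity)]
    nlinarith
  · rw [hq, Odd.neg_pow ⟨k + 1, by ring⟩, mul_pow, hpow]
    ring

lemma norm_suzukiP_mul_le (k : ℕ) (z : ℂ) : ‖(suzukiP (k + 2) : ℂ) * z‖ ≤ ‖z‖ := by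
  rw [norm_mul, Complex.norm_real]
  exact mul_le_of_le_one_left (norm_nonneg z) (suzukiP_spec k).1

lemma norm_one_sub_suzukiP_mul_le (k : ℕ) (z : ℂ) :
    ‖(1 - 4 * (suzukiP (k + 2) : ℂ)) * z‖ ≤ ‖z‖ := by
  rw [norm_mul, show (1 - 4 * (suzukiP (k + 2) : ℂ)) = ((1 - 4 * suzukiP (k + 2) : ℝ) : ℂ) by
    push_cast; ring, Complex.norm_real]
  exact mul_le_of_le_one_left (norm_nonneg z) (suzukiP_spec k).2.1

lemma suzukiP_cancel (k : ℕ) : 4 * (suzukiP (k + 2) : ℂ) ^ (2 * k + 3) +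
    (1 - 4 * (suzukiP (k + 2) : ℂ)) ^ (2 * k + 3) = 0 := by
  exact_mod_cast congrArg (fun x : ℝ => (x : ℂ)) (suzukiP_spec k).2.2

end SuzukiParameter

/-! ### Stability, symmetry and order of Suzuki's recursion -/

section Suzuki

variable {𝔸 : Type*} [NormedRing 𝔸]

lemma norm_mul_sub_mul_le {a b a' b' : 𝔸} {K L ε δ : ℝ} (hb : ‖b‖ ≤ L) (ha' : ‖a'‖ ≤ K)
    (h : ‖a - a'‖ ≤ ε) (h' : ‖b - b'‖ ≤ δ) : ‖a * b - a' * b'‖ ≤ ε * L + K * δ := by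
  have : a * b - a' * b' = (a - a') * b + a' * (b - b') := by noncomm_ring
  rw [this]
  refine (norm_add_le _ _).trans (add_le_add ((norm_mul_le _ _).trans ?_)
    ((norm_mul_le _ _).trans ?_))
  · exact mul_le_mul h hb (norm_nonneg _) ((norm_nonneg _).trans h)
  · exact mul_le_mul ha' h' (norm_nonneg _) ((norm_nonneg _).trans ha')

lemma norm_sq_mul_mul_sq_le {x y : 𝔸} {L : ℝ} (hx : ‖x‖ ≤ L) (hy : ‖y‖ ≤ L) :
    ‖x ^ 2 * y * x ^ 2‖ ≤ L ^ 5 := by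
  have hL : 0 ≤ L := (norm_nonneg _).trans hx
  have h2 : ‖x ^ 2‖ ≤ L ^ 2 := (norm_pow_le' x two_pos).trans (by gcongr)
  calc ‖x ^ 2 * y * x ^ 2‖ ≤ ‖x ^ 2‖ * ‖y‖ * ‖x ^ 2‖ := by
        refine (norm_mul_le _ _).trans ?_
        gcongr
        exact norm_mul_le _ _
    _ ≤ L ^ 2 * L * L ^ 2 := by gcongr
    _ = L ^ 5 := by ring

lemma norm_sq_mul_mul_sq_sub_le {x y x' y' : 𝔸} {L ε : ℝ} (hx : ‖x‖ ≤ L) (hy : ‖y‖ ≤ L)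
    (hx' : ‖x'‖ ≤ L) (hy' : ‖y'‖ ≤ L) (h : ‖x - x'‖ ≤ ε) (h' : ‖y - y'‖ ≤ ε) :
    ‖x ^ 2 * y * x ^ 2 - x' ^ 2 * y' * x' ^ 2‖ ≤ 5 * L ^ 4 * ε := by
  have hL : 0 ≤ L := (norm_nonneg _).trans hx
  have b2 : ‖x ^ 2‖ ≤ L ^ 2 := (norm_pow_le' x two_pos).trans (by gcongr)
  have b2' : ‖x' ^ 2‖ ≤ L ^ 2 := (norm_pow_le' x' two_pos).trans (by gcongr)
  have h2 : ‖x ^ 2 - x' ^ 2‖ ≤ ε * L + L * ε := by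
    simpa only [pow_two] using norm_mul_sub_mul_le hx hx' h h
  have h3 := norm_mul_sub_mul_le hy b2' h2 h'
  have b3 : ‖x' ^ 2 * y'‖ ≤ L ^ 2 * L := (norm_mul_le _ _).trans (by gcongr)
  refine (norm_mul_sub_mul_le b2 b3 h3 h2).trans (le_of_eq ?_)
  ring

/-- Each level is a product of five factors of the previous one, at arguments no larger than `z`;
hence the exponent `5 ^ k`. -/
lemma norm_suzuki_le {S : ℂ → 𝔸} {K r : ℝ} (hS : ∀ z, ‖z‖ ≤ r → ‖S z‖ ≤ K) (k : ℕ) {z : ℂ}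
    (hz : ‖z‖ ≤ r) : ‖suzuki S (k + 1) z‖ ≤ K ^ 5 ^ k := by
  induction k generalizing z with
  | zero => simpa [suzuki] using hS z hz
  | succ k ih =>
    rw [pow_succ, pow_mul]
    exact norm_sq_mul_mul_sq_le (ih ((norm_suzukiP_mul_le k z).trans hz))
      (ih ((norm_one_sub_suzukiP_mul_le k z).trans hz))

/-- Stability of Suzuki's recursion with respect to the basic formula. -/
lemma norm_suzuki_sub_le {S T : ℂ → 𝔸} {K r ε : ℝ} (hS : ∀ z, ‖z‖ ≤ r → ‖S z‖ ≤ K)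
    (hT : ∀ z, ‖z‖ ≤ r → ‖T z‖ ≤ K) (hST : ∀ z, ‖z‖ ≤ r → ‖S z - T z‖ ≤ ε) (k : ℕ) {z : ℂ}
    (hz : ‖z‖ ≤ r) :
    ‖suzuki S (k + 1) z - suzuki T (k + 1) z‖ ≤
      (∏ i ∈ Finset.range k, 5 * (K ^ 5 ^ i) ^ 4) * ε := by
  induction k generalizing z with
  | zero => simpa [suzuki] using hST z hz
  | succ k ih =>
    have h1 := (norm_suzukiP_mul_le k z).trans hz
    have h2 := (norm_one_sub_suzukiP_mul_le k z).trans hz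
    rw [Finset.prod_range_succ, mul_comm (∏ i ∈ _, _), mul_assoc]
    exact norm_sq_mul_mul_sq_sub_le (norm_suzuki_le hS k h1) (norm_suzuki_le hS k h2)
      (norm_suzuki_le hT k h1) (norm_suzuki_le hT k h2) (ih h1) (ih h2)

/-- The five-factor word is a palindrome, so the product telescopes from the middle outwards. -/
lemma suzuki_mul_suzuki_neg {S : ℂ → 𝔸} (hS : ∀ z, S z * S (-z) = 1) (k : ℕ) (z : ℂ) :
    suzuki S (k + 1) z * suzuki S (k + 1) (-z) = 1 := by
  induction k generalizing z with
  | zero => exact hS z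
  | succ k ih =>
    have h1 := ih ((suzukiP (k + 2) : ℂ) * z)
    have h2 := ih ((1 - 4 * (suzukiP (k + 2) : ℂ)) * z)
    rw [← mul_neg] at h1 h2
    simp only [suzuki]
    generalize suzuki S (k + 1) ((suzukiP (k + 2) : ℂ) * z) = x at *
    generalize suzuki S (k + 1) ((1 - 4 * (suzukiP (k + 2) : ℂ)) * z) = y at *
    generalize suzuki S (k + 1) ((suzukiP (k + 2) : ℂ) * -z) = x' at *
    generalize suzuki S (k + 1) ((1 - 4 * (suzukiP (k + 2) : ℂ)) * -z) = y' at *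
    have e : x ^ 2 * y * x ^ 2 * (x' ^ 2 * y' * x' ^ 2) =
      x * (x * (y * (x * (x * x') * x') * y') * x') * x' := by noncomm_ring
    rw [e, h1, mul_one, h1, mul_one, h2, mul_one, h1, mul_one, h1]

lemma isBigO_one_of_sub_one {X : ℂ → 𝔸} (h : (fun z => X z - 1) =O[𝓝 0] fun z : ℂ => z) :
    X =O[𝓝 0] fun _ : ℂ => (1 : ℂ) := by
  have h1 : (fun z : ℂ => z) =O[𝓝 0] fun _ : ℂ => (1 : ℂ) :=
    (continuous_id.tendsto (0 : ℂ)).isBigO_one ℂ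
  have := (h.trans h1).add (isBigO_const_const (1 : 𝔸) (one_ne_zero (α := ℂ)) (𝓝 0))
  simpa using this

lemma isBigO_mul_sub_one {X Y : ℂ → 𝔸} (hX : (fun z => X z - 1) =O[𝓝 0] fun z : ℂ => z)
    (hY : (fun z => Y z - 1) =O[𝓝 0] fun z : ℂ => z) :
    (fun z => X z * Y z - 1) =O[𝓝 0] fun z : ℂ => z := by
  have h1 := hX.mul (isBigO_one_of_sub_one hY)
  simp only [mul_one] at h1
  refine (h1.add hY).congr_left fun z => ?_
  noncomm_ring

variable [NormedAlgebra ℂ 𝔸]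

lemma differentiable_suzuki {S : ℂ → 𝔸} (hS : Differentiable ℂ S) (k : ℕ) :
    Differentiable ℂ (suzuki S (k + 1)) := by
  induction k with
  | zero => exact hS
  | succ k ih =>
    have h (c : ℂ) : Differentiable ℂ fun z => suzuki S (k + 1) (c * z) :=
      ih.comp (differentiable_id.const_mul c)
    exact (((h _).pow 2).mul (h _)).mul ((h _).pow 2)

/-- Differentiability of Suzuki's recursion in a parameter. -/
lemma differentiable_suzuki_param {S : ℂ → ℂ → 𝔸}
    (hS : ∀ z, Differentiable ℂ fun t => S t z) (k : ℕ) (z : ℂ) :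
    Differentiable ℂ fun t => suzuki (S t) (k + 1) z := by
  induction k generalizing z with
  | zero => exact hS z
  | succ k ih => exact (((ih _).pow 2).mul (ih _)).mul ((ih _).pow 2)

/-- The five time steps sum to `4p + (1 - 4p) = 1`. The exact flow can thus be compared with a
product formula level by level. -/
lemma suzuki_exp [CompleteSpace 𝔸] (H : 𝔸) (k : ℕ) (z : ℂ) :
    suzuki (fun z : ℂ => NormedSpace.exp (z • H)) (k + 1) z = NormedSpace.exp (z • H) := by
  induction k generalizing z with
  | zero => rfl
  | succ k ih =>
    simp only [suzuki, ih, pow_two, exp_smul_mul_exp_smul]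
    congr 2
    ring

/-- `X` and `Y` are near-identity families with `X - Y = z ^ n e + O(z ^ (n + 1))`. -/
structure HasLeadingError (n : ℕ) (X Y : ℂ → 𝔸) (e : 𝔸) : Prop where
  left : (fun z => X z - 1) =O[𝓝 0] fun z : ℂ => z
  right : (fun z => Y z - 1) =O[𝓝 0] fun z : ℂ => z
  error : (fun z => X z - Y z - z ^ n • e) =O[𝓝 0] fun z : ℂ => z ^ (n + 1)

/-- Leading errors add, since every factor is `1 + O(z)` and multiplying an error by it changes only
higher orders. -/
lemma HasLeadingError.mul {n : ℕ} {X Y X' Y' : ℂ → 𝔸} {e e' : 𝔸} (h : HasLeadingError n X Y e)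
    (h' : HasLeadingError n X' Y' e') :
    HasLeadingError n (fun z => X z * X' z) (fun z => Y z * Y' z) (e + e') := by
  refine ⟨isBigO_mul_sub_one h.left h'.left, isBigO_mul_sub_one h.right h'.right, ?_⟩
  have hz (e : 𝔸) : (fun z : ℂ => z ^ n • e) =O[𝓝 0] fun z : ℂ => z ^ n := by
    simpa using (isBigO_refl (fun z : ℂ => z ^ n) (𝓝 0)).smul
      (isBigO_const_const e (one_ne_zero (α := ℂ)) (𝓝 0))
  have t1 := h.error.mul (isBigO_one_of_sub_one h'.left)
  have t2 := (hz e).mul h'.left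
  have t3 := (isBigO_one_of_sub_one h.right).mul h'.error
  have t4 := h.right.mul (hz e')
  simp only [mul_one, one_mul, ← pow_succ, ← pow_succ'] at t1 t2 t3 t4
  refine (((t1.add t2).add t3).add t4).congr_left fun z => ?_
  rw [smul_add]
  generalize z ^ n • e = a
  generalize z ^ n • e' = b
  noncomm_ring

lemma HasLeadingError.comp_mul {n : ℕ} {X Y : ℂ → 𝔸} {e : 𝔸} (h : HasLeadingError n X Y e)
    (c : ℂ) : HasLeadingError n (fun z => X (c * z)) (fun z => Y (c * z)) (c ^ n • e) := by
  have hc : Tendsto (fun z : ℂ => c * z) (𝓝 0) (𝓝 0) :=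
    (continuous_const.mul continuous_id).tendsto' _ _ (by simp)
  have hO (j : ℕ) : (fun z : ℂ => (c * z) ^ j) =O[𝓝 0] fun z : ℂ => z ^ j :=
    ((isBigO_refl (fun z : ℂ => z) (𝓝 0)).const_mul_left c).pow j
  refine ⟨(h.left.comp_tendsto hc).trans (by simpa [Function.comp_def] using hO 1),
    (h.right.comp_tendsto hc).trans (by simpa [Function.comp_def] using hO 1),
    ((h.error.comp_tendsto hc).trans (hO (n + 1))).congr_left fun z => ?_⟩
  simp [mul_pow, smul_smul, mul_comm]

variable [CompleteSpace 𝔸]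

lemma exp_smul_sub_one_isBigO (H : 𝔸) :
    (fun z : ℂ => NormedSpace.exp (z • H) - 1) =O[𝓝 0] fun z : ℂ => z := by
  have := (hasDerivAt_exp_smul_const H (0 : ℂ)).differentiableAt.isBigO_sub
  simpa using this

lemma HasLeadingError.of_isBigO {S : ℂ → 𝔸} {H : 𝔸} (hS : Differentiable ℂ S) {n : ℕ}
    (h : (fun z => S z - NormedSpace.exp (z • H)) =O[𝓝 0] fun z : ℂ => z ^ (n + 1)) :
    ∃ e, HasLeadingError (n + 1) S (fun z => NormedSpace.exp (z • H)) e := by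
  have hE : Differentiable ℂ fun z : ℂ => NormedSpace.exp (z • H) :=
    differentiable_exp.comp (differentiable_id.smul_const H)
  obtain ⟨e, he⟩ := exists_leading_coeff (hS.sub hE) h
  refine ⟨e, ?_, exp_smul_sub_one_isBigO H, he⟩
  have hz : (fun z : ℂ => z ^ (n + 1)) =O[𝓝 0] fun z : ℂ => z := by
    have := (isBigO_refl (fun z : ℂ => z) (𝓝 0)).mul
      ((continuous_pow n).tendsto (0 : ℂ) |>.isBigO_one ℂ)
    simpa [← pow_succ'] using this
  exact ((h.trans hz).add (exp_smul_sub_one_isBigO H)).congr_left fun z => by abel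

/-- A time-symmetric formula has even order. -/
lemma isBigO_of_symmetric {S : ℂ → 𝔸} {H : 𝔸} (hS : Differentiable ℂ S)
    (hsymm : ∀ z, S z * S (-z) = 1) {j : ℕ}
    (h : (fun z => S z - NormedSpace.exp (z • H)) =O[𝓝 0] fun z : ℂ => z ^ (2 * j + 2)) :
    (fun z => S z - NormedSpace.exp (z • H)) =O[𝓝 0] fun z : ℂ => z ^ (2 * j + 3) := by
  obtain ⟨e, he⟩ := HasLeadingError.of_isBigO hS h
  -- The products of `S` and of the exponential at `z` and `-z` are both 1, while the even exponent
  -- gives the two leading errors the same sign: `e + e = 0`.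
  have h2 := (he.mul (he.comp_mul (-1))).error
  have hexp (z : ℂ) : NormedSpace.exp (z • H) * NormedSpace.exp ((-1 * z) • H) = 1 := by
    rw [neg_one_mul, neg_smul, exp_mul_exp_neg]
  simp only [hexp] at h2
  simp only [neg_one_mul, hsymm, sub_self, zero_sub,
    Even.neg_one_pow (show Even (2 * j + 1 + 1) from ⟨j + 1, by ring⟩), one_smul] at h2
  have h0 : e + e = 0 := eq_zero_of_pow_smul_isBigO (h2.neg_left.congr_left fun z => neg_neg _)
  have he0 : e = 0 := by
    rw [← two_smul ℂ] at h0
    exact (smul_eq_zero.1 h0).resolve_left two_ne_zero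
  simpa [he0] using he.error

/-- Suzuki's recursion raises the order of a symmetric second-order formula. -/
lemma suzuki_sub_exp_isBigO {S : ℂ → 𝔸} {H : 𝔸} (hS : Differentiable ℂ S)
    (hsymm : ∀ z, S z * S (-z) = 1)
    (h : (fun z => S z - NormedSpace.exp (z • H)) =O[𝓝 0] fun z : ℂ => z ^ 2) (k : ℕ) :
    (fun z => suzuki S (k + 1) z - NormedSpace.exp (z • H)) =O[𝓝 0]
      fun z : ℂ => z ^ (2 * k + 3) := by
  induction k with
  | zero => exact isBigO_of_symmetric (j := 0) hS hsymm h
  | succ k ih =>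
    refine isBigO_of_symmetric (j := k + 1) (differentiable_suzuki hS (k + 1))
      (suzuki_mul_suzuki_neg hsymm (k + 1)) ?_
    obtain ⟨e, he⟩ := HasLeadingError.of_isBigO (differentiable_suzuki hS k) ih
    have hp := he.comp_mul (suzukiP (k + 2) : ℂ)
    have hq := he.comp_mul (1 - 4 * (suzukiP (k + 2) : ℂ))
    -- The leading coefficient is `(4p^(2k+3) + (1-4p)^(2k+3)) e`, zero by the choice of `p`. This
    -- gains one order; the symmetry invoked above gains the second.
    have := (((hp.mul hp).mul hq).mul (hp.mul hp)).error
    simp only [exp_smul_mul_exp_smul] at this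
    refine this.congr_left fun z => ?_
    have hc : ∀ p q : ℂ, p • e + p • e + q • e + (p • e + p • e) = (4 * p + q) • e := by
      intro p q; module
    rw [hc, show 2 * k + 2 + 1 = 2 * k + 3 from rfl, suzukiP_cancel, zero_smul, smul_zero, sub_zero]
    simp only [suzuki, pow_two]
    congr 3
    ring

end Suzuki

end CorrectedPF

namespace CorrectedPF

open Asymptotics Filter Topology

noncomputable section

/-! ### The commutator operator and its exponential -/

section Ad

variable {𝔸 : Type*} [NormedRing 𝔸] [NormedAlgebra ℂ 𝔸]

/-- The commutator map `ad_A` as a continuous linear map. -/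
def adL (A : 𝔸) : 𝔸 →L[ℂ] 𝔸 := ContinuousLinearMap.mul ℂ 𝔸 A - (ContinuousLinearMap.mul ℂ 𝔸).flip A

lemma adL_apply (A X : 𝔸) : adL A X = A * X - X * A := rfl

lemma adL_smul (A : 𝔸) (s : ℂ) : adL (s • A) = s • adL A := by
  ext X
  simp [adL_apply, smul_sub]

lemma adOp_iterate (A X : 𝔸) (n : ℕ) : (adOp A)^[n] X = (adL A ^ n) X := by
  induction n with
  | zero => rfl
  | succ n ih =>
    rw [Function.iterate_succ_apply', ih, pow_succ', mul_apply_eq_comp, adL_apply, adOp]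

lemma norm_adL_le {A : 𝔸} {M : ℝ} (hA : ‖A‖ ≤ M) : ‖adL A‖ ≤ 2 * M := by
  have hM : 0 ≤ M := (norm_nonneg A).trans hA
  refine ContinuousLinearMap.opNorm_le_bound _ (by positivity) fun X => ?_
  rw [adL_apply]
  calc ‖A * X - X * A‖ ≤ ‖A‖ * ‖X‖ + ‖X‖ * ‖A‖ :=
        (norm_sub_le _ _).trans (add_le_add (norm_mul_le _ _) (norm_mul_le _ _))
    _ = 2 * ‖A‖ * ‖X‖ := by ring
    _ ≤ 2 * M * ‖X‖ := by gcongr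

lemma norm_smul_adL_le {A : 𝔸} {M : ℝ} (hA : ‖A‖ ≤ M) (z : ℂ) : ‖z • adL A‖ ≤ 2 * M * ‖z‖ := by
  refine (norm_smul_le z (adL A)).trans ?_
  rw [mul_comm]
  exact mul_le_mul_of_nonneg_right (norm_adL_le hA) (norm_nonneg z)

variable [CompleteSpace 𝔸]

lemma exp_mulLeft_apply (A X : 𝔸) :
    NormedSpace.exp (ContinuousLinearMap.mul ℂ 𝔸 A) X = NormedSpace.exp A * X := by
  have h1 := (NormedSpace.exp_series_hasSum_exp' (𝕂 := ℂ) (ContinuousLinearMap.mul ℂ 𝔸 A)).mapL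
    (ContinuousLinearMap.apply ℂ 𝔸 X)
  have h2 := (NormedSpace.exp_series_hasSum_exp' (𝕂 := ℂ) A).mul_right X
  refine h1.unique (h2.congr_fun fun n => ?_)
  have (n : ℕ) : (ContinuousLinearMap.mul ℂ 𝔸 A ^ n) X = A ^ n * X := by
    induction n with
    | zero => simp
    | succ n ih =>
      rw [pow_succ', mul_apply_eq_comp, ih, ContinuousLinearMap.mul_apply', pow_succ',
        mul_assoc]
  simp [this]

lemma exp_mulRight_apply (A X : 𝔸) :
    NormedSpace.exp ((ContinuousLinearMap.mul ℂ 𝔸).flip A) X = X * NormedSpace.exp A := by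
  have h1 := (NormedSpace.exp_series_hasSum_exp' (𝕂 := ℂ)
    ((ContinuousLinearMap.mul ℂ 𝔸).flip A)).mapL (ContinuousLinearMap.apply ℂ 𝔸 X)
  have h2 := (NormedSpace.exp_series_hasSum_exp' (𝕂 := ℂ) A).mul_left X
  refine h1.unique (h2.congr_fun fun n => ?_)
  have (n : ℕ) : ((ContinuousLinearMap.mul ℂ 𝔸).flip A ^ n) X = X * A ^ n := by
    induction n with
    | zero => simp
    | succ n ih =>
      rw [pow_succ', mul_apply_eq_comp, ih, ContinuousLinearMap.flip_apply,
        ContinuousLinearMap.mul_apply', pow_succ, mul_assoc]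
  simp [this]

/-- `e^{ad_A}(X) = e^A X e^{-A}`. -/
lemma exp_adL_apply_mul_exp (A X : 𝔸) :
    NormedSpace.exp (adL A) X * NormedSpace.exp A = NormedSpace.exp A * X := by
  let _ : NormedAlgebra ℚ (𝔸 →L[ℂ] 𝔸) := NormedAlgebra.restrictScalars ℚ ℂ _
  -- Left multiplication by `A` is `ad_A` plus right multiplication by `A`, and these two commute,
  -- so its exponential factors.
  have hc : Commute ((ContinuousLinearMap.mul ℂ 𝔸).flip A) (adL A) := by
    refine ContinuousLinearMap.ext fun Y => ?_
    simp only [mul_apply_eq_comp, adL_apply, ContinuousLinearMap.flip_apply,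
      ContinuousLinearMap.mul_apply']
    noncomm_ring
  rw [← exp_mulRight_apply, ← exp_mulLeft_apply, ← mul_apply_eq_comp,
    ← NormedSpace.exp_add_of_commute hc]
  congr 2
  simp [adL]

end Ad

/-! ### The corrector as a polynomial in `ad_A` -/

section Corrector

variable {𝔸 : Type*} [NormedRing 𝔸] [NormedAlgebra ℂ 𝔸]

lemma algebraMap_clm_apply (c : ℂ) (X : 𝔸) : algebraMap ℂ (𝔸 →L[ℂ] 𝔸) c X = c • X := rfl

lemma smul_clm_pow_apply (T : 𝔸 →L[ℂ] 𝔸) (z : ℂ) (n : ℕ) (X : 𝔸) :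
    ((z • T) ^ n) X = z ^ n • (T ^ n) X := by
  induction n with
  | zero => simp
  | succ n ih =>
    rw [pow_succ', mul_apply_eq_comp, ih, _root_.smul_apply, map_smul, smul_smul, ← pow_succ',
      pow_succ' T, mul_apply_eq_comp]

lemma corrector_one_eq (m : ℕ) (A B : 𝔸) (z : ℂ) : corrector m A B 1 z =
    ∑ j ∈ Finset.Icc 1 m, ((corrCoeff j : ℂ) * z ^ (2 * j)) • (adL A ^ (2 * j - 1)) B := by
  simp [corrector, adOp_iterate]

lemma corrector_eq_smul (m : ℕ) (A B : 𝔸) (α : ℝ) (z : ℂ) :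
    corrector m A B α z = (α : ℂ) • corrector m A B 1 z := by
  simp [corrector]

lemma corrector_smul (m : ℕ) (A B : 𝔸) (t z : ℂ) :
    corrector m A (t • B) 1 z = t • corrector m A B 1 z := by
  simp only [corrector_one_eq, map_smul, Finset.smul_sum]
  exact Finset.sum_congr rfl fun j _ => smul_comm _ _ _

lemma corrector_neg (m : ℕ) (A B : 𝔸) (α : ℝ) (z : ℂ) :
    corrector m A B α (-z) = corrector m A B α z := by
  simp [corrector, Even.neg_pow]

/-- Moving `α` into `B` lets it be replaced by a complex parameter. -/
lemma pf2_eq (A B : 𝔸) (α : ℝ) : pf2 A B α = pf2 A ((α : ℂ) • B) 1 := by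
  funext z
  simp only [pf2, smul_smul, mul_comm z, Complex.ofReal_one, one_mul]

lemma cpf2_eq (m : ℕ) (A B : 𝔸) (α : ℝ) : cpf2 m A B α = cpf2 m A ((α : ℂ) • B) 1 := by
  funext z
  rw [cpf2, cpf2, corrector_smul, ← corrector_eq_smul, pf2_eq]

/-- A bound for the corrector on the disc of radius `2`. -/
def correctorBound (m : ℕ) (M : ℝ) : ℝ :=
  ∑ j ∈ Finset.Icc 1 m, ‖(corrCoeff j : ℂ)‖ * 2 ^ (2 * j) * ((2 * M) ^ (2 * j - 1) * M)

lemma norm_corrector_le [NormOneClass 𝔸] (m : ℕ) {A B : 𝔸} {M : ℝ} (hA : ‖A‖ ≤ M) (hB : ‖B‖ ≤ M)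
    {z : ℂ} (hz : ‖z‖ ≤ 2) : ‖corrector m A B 1 z‖ ≤ correctorBound m M := by
  have : Nontrivial 𝔸 := NormOneClass.nontrivial
  have hM : 0 ≤ M := (norm_nonneg A).trans hA
  rw [corrector_one_eq]
  refine norm_sum_le_of_le _ fun j _ => ?_
  rw [norm_smul, norm_mul, norm_pow]
  gcongr
  refine (ContinuousLinearMap.le_opNorm _ _).trans ?_
  gcongr
  exact (norm_pow_le _ _).trans (by gcongr; exact norm_adL_le hA)

lemma corrector_isBigO (m : ℕ) (A B : 𝔸) :
    (fun z => corrector m A B 1 z) =O[𝓝 0] fun z : ℂ => z ^ 2 := by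
  simp only [corrector_one_eq]
  refine IsBigO.fun_sum fun j hj => ?_
  have h1 : (fun z : ℂ => z ^ (2 * (j - 1))) =O[𝓝 0] fun _ : ℂ => (1 : ℂ) :=
    ((continuous_pow (2 * (j - 1))).tendsto (0 : ℂ)).isBigO_one ℂ
  have h2 := ((isBigO_refl (fun z : ℂ => z ^ 2) (𝓝 0)).mul h1).smul
    (isBigO_const_const ((corrCoeff j : ℂ) • (adL A ^ (2 * j - 1)) B) (one_ne_zero (α := ℂ)) (𝓝 0))
  simp only [mul_one, smul_eq_mul] at h2
  refine h2.congr_left fun z => ?_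
  rw [← pow_add, smul_smul, mul_comm]
  congr 3
  have := (Finset.mem_Icc.1 hj).1
  omega

/-- The derivative of the corrector. -/
def correctorDeriv (m : ℕ) (A B : 𝔸) (z : ℂ) : 𝔸 :=
  ∑ j ∈ Finset.Icc 1 m,
    ((corrCoeff j : ℂ) * (((2 * j : ℕ) : ℂ) * z ^ (2 * j - 1))) • (adL A ^ (2 * j - 1)) B

lemma hasDerivAt_corrector (m : ℕ) (A B : 𝔸) (z : ℂ) :
    HasDerivAt (fun z => corrector m A B 1 z) (correctorDeriv m A B z) z := by
  simp only [corrector_one_eq]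
  exact HasDerivAt.fun_sum fun j _ => ((hasDerivAt_pow (2 * j) z).const_mul _).smul_const _

lemma differentiable_corrector (m : ℕ) (A B : 𝔸) :
    Differentiable ℂ fun z => corrector m A B 1 z := fun z =>
  (hasDerivAt_corrector m A B z).differentiableAt

open Polynomial in
-- The term `j = 0` gives `B`; every other term has one more factor `ad_A` than the corrector.
-- Together with its analogue for the derivative, this turns the scalar differential equation into a
-- statement about the corrector.
lemma aeval_bernoulliPoly_apply (m : ℕ) (A B : 𝔸) (z : ℂ) :
    aeval (z • adL A) (bernoulliPoly m) B = B + adL A (corrector m A B 1 z) := by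
  rw [bernoulliPoly, Finset.range_eq_Ico, Finset.sum_eq_sum_Ico_succ_bot (Nat.succ_pos m),
    corrector_one_eq, map_sum, ← bernoulliHalf_two_mul 0, mul_zero, bernoulliHalf_zero]
  simp only [map_add, map_mul, map_sum, map_pow, aeval_X, aeval_C, map_one, pow_zero, mul_one,
    _root_.add_apply, one_apply_eq_self, _root_.sum_apply]
  congr 1
  refine Finset.sum_congr (by ext; simp) fun j hj => ?_
  have hj : 2 * j = 2 * j - 1 + 1 := by have := (Finset.mem_Icc.1 hj).1; omega
  rw [mul_apply_eq_comp, algebraMap_clm_apply, smul_clm_pow_apply, map_smul, smul_smul,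
    ← mul_apply_eq_comp, ← pow_succ', ← hj]

open Polynomial in
lemma aeval_derivative_bernoulliPoly_apply (m : ℕ) (A B : 𝔸) (z : ℂ) :
    aeval (z • adL A) (derivative (bernoulliPoly m)) B = correctorDeriv m A B z := by
  rw [bernoulliPoly, Finset.range_eq_Ico, Finset.sum_eq_sum_Ico_succ_bot (Nat.succ_pos m),
    correctorDeriv]
  simp only [map_add, map_sum, derivative_C_mul, derivative_X_pow, mul_zero, Nat.cast_zero,
    map_zero, zero_mul, zero_add, map_mul, map_pow, aeval_X, aeval_C, _root_.sum_apply]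
  refine Finset.sum_congr (by ext; simp) fun j hj => ?_
  simp only [mul_apply_eq_comp, algebraMap_clm_apply, smul_clm_pow_apply, smul_smul]

end Corrector

end

end CorrectedPF

namespace CorrectedPF

open Asymptotics Filter Topology

noncomputable section

variable {𝔸 : Type*} [NormedRing 𝔸] [NormedAlgebra ℂ 𝔸]

lemma norm_smul_le_two_mul {X : 𝔸} {M : ℝ} (hX : ‖X‖ ≤ M) {z : ℂ} (hz : ‖z‖ ≤ 2) :
    ‖z • X‖ ≤ 2 * M := by
  rw [norm_smul]
  exact mul_le_mul hz hX (norm_nonneg _) zero_le_two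

variable [CompleteSpace 𝔸]

/-! ### Symmetry, bounds and consistency of the second-order formulas -/

section SecondOrder

lemma pf2_mul_pf2_neg (A B : 𝔸) (z : ℂ) : pf2 A B 1 z * pf2 A B 1 (-z) = 1 := by
  have h1 := exp_mul_exp_neg ((z / 2) • A)
  have h2 := exp_mul_exp_neg (z • B)
  rw [← neg_smul] at h1 h2
  simp only [pf2, Complex.ofReal_one, one_mul, neg_div]
  generalize NormedSpace.exp ((z / 2) • A) = x at *
  generalize NormedSpace.exp (-(z / 2) • A) = x' at *
  generalize NormedSpace.exp (z • B) = y at *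
  generalize NormedSpace.exp (-z • B) = y' at *
  have e : x * y * x * (x' * y' * x') = x * (y * (x * x') * y') * x' := by noncomm_ring
  rw [e, h1, mul_one, h2, mul_one, h1]

/-- The corrector is even in `z`, so the same conjugation acts at `z` and `-z` and preserves time
symmetry. -/
lemma cpf2_mul_cpf2_neg (m : ℕ) (A B : 𝔸) (z : ℂ) : cpf2 m A B 1 z * cpf2 m A B 1 (-z) = 1 := by
  have h1 := exp_neg_mul_exp (corrector m A B 1 z)
  have h2 := exp_mul_exp_neg (corrector m A B 1 z)
  have h3 := pf2_mul_pf2_neg A B z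
  simp only [cpf2, corrector_neg]
  generalize NormedSpace.exp (corrector m A B 1 z) = x at *
  generalize NormedSpace.exp (-corrector m A B 1 z) = x' at *
  generalize pf2 A B 1 z = y at *
  generalize pf2 A B 1 (-z) = y' at *
  have e : x * y * x' * (x * y' * x') = x * (y * (x' * x) * y') * x' := by noncomm_ring
  rw [e, h1, mul_one, h3, mul_one, h2]

lemma differentiable_pf2 (A B : 𝔸) : Differentiable ℂ (pf2 A B 1) := by
  have h1 : Differentiable ℂ fun z : ℂ => NormedSpace.exp ((z / 2) • A) :=
    differentiable_exp.comp ((differentiable_id.div_const 2).smul_const A)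
  have h2 : Differentiable ℂ fun z : ℂ => NormedSpace.exp ((((1 : ℝ) : ℂ) * z) • B) :=
    differentiable_exp.comp ((differentiable_id.const_mul _).smul_const B)
  exact (h1.mul h2).mul h1

lemma differentiable_cpf2 (m : ℕ) (A B : 𝔸) : Differentiable ℂ (cpf2 m A B 1) :=
  ((differentiable_exp.comp (differentiable_corrector m A B)).mul (differentiable_pf2 A B)).mul
    (differentiable_exp.comp (differentiable_corrector m A B).neg)

lemma differentiable_pf2_param (A B : 𝔸) (z : ℂ) :
    Differentiable ℂ fun t : ℂ => pf2 A (t • B) 1 z := by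
  have h : Differentiable ℂ fun t : ℂ => NormedSpace.exp ((((1 : ℝ) : ℂ) * z) • t • B) :=
    differentiable_exp.comp ((differentiable_id.smul_const B).const_smul (((1 : ℝ) : ℂ) * z))
  exact (h.const_mul _).mul_const _

lemma differentiable_cpf2_param (m : ℕ) (A B : 𝔸) (z : ℂ) :
    Differentiable ℂ fun t : ℂ => cpf2 m A (t • B) 1 z := by
  have h : Differentiable ℂ fun t : ℂ => corrector m A (t • B) 1 z := by
    simp only [corrector_smul]
    exact differentiable_id.smul_const _
  exact ((differentiable_exp.comp h).mul (differentiable_pf2_param A B z)).mul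
    (differentiable_exp.comp h.neg)

/-- Measured against the constant family 1 with `n = 1`, the leading error is the first Taylor
coefficient; the conjugating exponentials contribute none. -/
lemma hasLeadingError_exp_of_isBigO {C : ℂ → 𝔸} (hC : C =O[𝓝 0] fun z : ℂ => z ^ 2) :
    HasLeadingError 1 (fun z : ℂ => NormedSpace.exp (C z)) (fun _ => 1) 0 := by
  have hz : Tendsto (fun z : ℂ => z ^ 2) (𝓝 0) (𝓝 0) := (continuous_pow 2).tendsto' _ _ (by simp)
  have hC0 : Tendsto C (𝓝 0) (𝓝 0) := hC.trans_tendsto hz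
  have h1 : (fun z => NormedSpace.exp (C z) - 1) =O[𝓝 0] fun z : ℂ => z ^ 2 := by
    have := ((differentiable_exp (𝔸 := 𝔸) 0).isBigO_sub).comp_tendsto hC0
    simp only [NormedSpace.exp_zero, sub_zero] at this
    exact this.trans hC
  refine ⟨h1.trans ?_, by simpa using isBigO_zero _ _, by simpa using h1⟩
  simpa using (isLittleO_pow_pow (𝕜 := ℂ) one_lt_two).isBigO

section Bounds

variable [NormOneClass 𝔸]

lemma norm_exp_half_smul_le {A : 𝔸} {M : ℝ} (hA : ‖A‖ ≤ M) {z : ℂ} (hz : ‖z‖ ≤ 2) :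
    ‖NormedSpace.exp ((z / 2) • A)‖ ≤ Real.exp M := by
  refine norm_exp_le_of_le ?_
  rw [norm_smul, norm_div, Complex.norm_two]
  exact (mul_le_of_le_one_left (norm_nonneg _) (by linarith)).trans hA

lemma norm_pf2_le {A B : 𝔸} {M : ℝ} (hA : ‖A‖ ≤ M) (hB : ‖B‖ ≤ M) {z : ℂ} (hz : ‖z‖ ≤ 2) :
    ‖pf2 A B 1 z‖ ≤ Real.exp (4 * M) := by
  have h2 : ‖NormedSpace.exp ((((1 : ℝ) : ℂ) * z) • B)‖ ≤ Real.exp (2 * M) := by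
    simpa using norm_exp_le_of_le (norm_smul_le_two_mul hB hz)
  have h1 := norm_exp_half_smul_le hA hz
  calc ‖pf2 A B 1 z‖ ≤ Real.exp M * Real.exp (2 * M) * Real.exp M := by
        refine (norm_mul_le _ _).trans ?_
        gcongr
        refine (norm_mul_le _ _).trans ?_
        gcongr
    _ = Real.exp (4 * M) := by rw [← Real.exp_add, ← Real.exp_add]; ring_nf

/-- A bound for the corrected second-order formula on the disc of radius `2`. -/
def cpf2Bound (m : ℕ) (M : ℝ) : ℝ :=
  Real.exp (correctorBound m M) * Real.exp (4 * M) * Real.exp (correctorBound m M)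

lemma norm_cpf2_le (m : ℕ) {A B : 𝔸} {M : ℝ} (hA : ‖A‖ ≤ M) (hB : ‖B‖ ≤ M) {z : ℂ}
    (hz : ‖z‖ ≤ 2) : ‖cpf2 m A B 1 z‖ ≤ cpf2Bound m M := by
  have hc := norm_corrector_le m hA hB hz
  refine (norm_mul_le _ _).trans (mul_le_mul ((norm_mul_le _ _).trans (mul_le_mul
    (norm_exp_le_of_le hc) (norm_pf2_le hA hB hz) (norm_nonneg _) (by positivity)))
    (norm_exp_le_of_le (by rwa [norm_neg])) (norm_nonneg _) (by positivity))

lemma norm_exp_smul_add_le {A B : 𝔸} {M : ℝ} (hA : ‖A‖ ≤ M) (hB : ‖B‖ ≤ M) {z : ℂ}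
    (hz : ‖z‖ ≤ 2) : ‖NormedSpace.exp (z • (A + B))‖ ≤ Real.exp (4 * M) := by
  have : ‖A + B‖ ≤ 2 * M := (norm_add_le _ _).trans (by linarith)
  exact (norm_exp_le_of_le (norm_smul_le_two_mul this hz)).trans_eq (by ring_nf)

lemma hasLeadingError_exp_smul (X : 𝔸) :
    HasLeadingError 1 (fun z : ℂ => NormedSpace.exp (z • X)) (fun _ => 1) X := by
  refine ⟨exp_smul_sub_one_isBigO X, by simpa using isBigO_zero _ _, ?_⟩
  refine IsBigO.of_bound (‖X‖ ^ 2 * Real.exp ‖X‖) ?_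
  filter_upwards [Metric.closedBall_mem_nhds (0 : ℂ) one_pos] with z hz
  rw [mem_closedBall_zero_iff] at hz
  obtain ⟨y, hy, h⟩ := exists_exp_eq_add_pow_mul 2 (z • X)
  rw [h]
  simp only [Finset.sum_range_succ, Finset.sum_range_zero, Nat.factorial, pow_zero, pow_one,
    Nat.cast_one, inv_one, one_smul, zero_add, mul_one]
  rw [show (1 + z • X + (z • X) ^ 2 * y - 1 - z • X : 𝔸) = (z • X) ^ 2 * y by abel, norm_pow]
  have hzX : ‖z • X‖ = ‖z‖ * ‖X‖ := norm_smul _ _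
  calc ‖(z • X) ^ 2 * y‖ ≤ ‖z • X‖ ^ 2 * Real.exp ‖z • X‖ := by
        refine (norm_mul_le _ _).trans ?_
        gcongr
        exact norm_pow_le _ _
    _ ≤ (‖z‖ * ‖X‖) ^ 2 * Real.exp ‖X‖ := by
        rw [hzX]
        gcongr
        exact mul_le_of_le_one_left (norm_nonneg _) hz
    _ = ‖X‖ ^ 2 * Real.exp ‖X‖ * ‖z‖ ^ (1 + 1) := by ring

lemma hasLeadingError_pf2 (A B : 𝔸) : HasLeadingError 1 (pf2 A B 1) (fun _ => 1) (A + B) := by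
  have hA : HasLeadingError 1 (fun z : ℂ => NormedSpace.exp ((z / 2) • A)) (fun _ => 1)
      ((1 / 2 : ℂ) • A) := by
    simpa only [smul_smul, mul_one_div] using hasLeadingError_exp_smul ((1 / 2 : ℂ) • A)
  have hB : HasLeadingError 1 (fun z : ℂ => NormedSpace.exp ((((1 : ℝ) : ℂ) * z) • B))
      (fun _ => 1) B := by
    simpa using hasLeadingError_exp_smul B
  have h := (hA.mul hB).mul hA
  simp only [mul_one] at h
  have e : A + B = (1 / 2 : ℂ) • A + B + (1 / 2 : ℂ) • A := by module
  rw [e]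
  exact h

lemma hasLeadingError_cpf2 (m : ℕ) (A B : 𝔸) :
    HasLeadingError 1 (cpf2 m A B 1) (fun _ => 1) (A + B) := by
  have h := ((hasLeadingError_exp_of_isBigO (corrector_isBigO m A B)).mul
    (hasLeadingError_pf2 A B)).mul (hasLeadingError_exp_of_isBigO (corrector_isBigO m A B).neg_left)
  simp only [mul_one, zero_add, add_zero] at h
  exact h

lemma HasLeadingError.sub_exp_isBigO {S : ℂ → 𝔸} {H : 𝔸}
    (h : HasLeadingError 1 S (fun _ => 1) H) :
    (fun z => S z - NormedSpace.exp (z • H)) =O[𝓝 0] fun z : ℂ => z ^ 2 :=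
  (h.error.sub (hasLeadingError_exp_smul H).error).congr_left fun z => by abel

end Bounds

end SecondOrder

/-! ### The linear term in the perturbation and its residual -/

section FirstOrderInPerturbation

/-- The coefficient of the first power of the perturbation in the corrected formula. -/
def linearTerm (m : ℕ) (A B : 𝔸) (z : ℂ) : 𝔸 :=
  z • (NormedSpace.exp ((z / 2) • A) * B * NormedSpace.exp ((z / 2) • A))
    + corrector m A B 1 z * NormedSpace.exp (z • A)
    - NormedSpace.exp (z • A) * corrector m A B 1 z

lemma exp_half_mul_exp_half (A : 𝔸) (z : ℂ) :
    NormedSpace.exp ((z / 2) • A) * NormedSpace.exp ((z / 2) • A) = NormedSpace.exp (z • A) := by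
  rw [exp_smul_mul_exp_smul, add_halves]

lemma pf2_zero (A : 𝔸) (z : ℂ) : pf2 A 0 1 z = NormedSpace.exp (z • A) := by
  simp [pf2, exp_half_mul_exp_half]

lemma cpf2_zero (m : ℕ) (A : 𝔸) (z : ℂ) : cpf2 m A 0 1 z = NormedSpace.exp (z • A) := by
  have : corrector m A 0 1 z = 0 := by simp [corrector_one_eq]
  simp [cpf2, this, pf2_zero]

lemma hasDerivAt_exp_smul_zero (X : 𝔸) :
    HasDerivAt (fun t : ℂ => NormedSpace.exp (t • X)) X 0 := by
  simpa using hasDerivAt_exp_smul_const X (0 : ℂ)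

lemma hasDerivAt_cpf2_param (m : ℕ) (A B : 𝔸) (z : ℂ) :
    HasDerivAt (fun t : ℂ => cpf2 m A (t • B) 1 z) (linearTerm m A B z) 0 := by
  have h1 := hasDerivAt_exp_smul_zero (corrector m A B 1 z)
  have h2 := hasDerivAt_exp_smul_zero (-corrector m A B 1 z)
  have h3 := hasDerivAt_exp_smul_zero (z • B)
  have h := (h1.mul ((h3.const_mul (NormedSpace.exp ((z / 2) • A))).mul_const
    (NormedSpace.exp ((z / 2) • A)))).mul h2
  have e : (fun t : ℂ => cpf2 m A (t • B) 1 z) = fun t : ℂ =>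
      NormedSpace.exp (t • corrector m A B 1 z) * (NormedSpace.exp ((z / 2) • A) *
        NormedSpace.exp (t • z • B) * NormedSpace.exp ((z / 2) • A)) *
        NormedSpace.exp (t • -corrector m A B 1 z) := by
    funext t
    simp only [cpf2, corrector_smul, pf2, Complex.ofReal_one, one_mul, smul_neg, smul_comm t z]
  rw [e]
  refine h.congr_deriv ?_
  simp only [Pi.mul_apply, zero_smul, NormedSpace.exp_zero, mul_one, one_mul, exp_half_mul_exp_half,
    linearTerm, mul_smul_comm, smul_mul_assoc, mul_neg]
  abel

/-- The residual of the linear term in the differential equation for the linearised flow. -/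
def linearResidual (m : ℕ) (A B : 𝔸) (z : ℂ) : 𝔸 :=
  NormedSpace.exp ((z / 2) • A) * B * NormedSpace.exp ((z / 2) • A)
    - (z / 2) • (NormedSpace.exp ((z / 2) • A) * (A * B - B * A) * NormedSpace.exp ((z / 2) • A))
    + correctorDeriv m A B z * NormedSpace.exp (z • A)
    - NormedSpace.exp (z • A) * correctorDeriv m A B z
    - (A * corrector m A B 1 z - corrector m A B 1 z * A) * NormedSpace.exp (z • A)
    - B * NormedSpace.exp (z • A)

/-- The derivative of `exp(z(A + tB))` at `t = 0` solves `P' = A P + B e^(zA)`; `linearResidual` is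
the defect of `linearTerm` in this equation. -/
lemma hasDerivAt_linearTerm (m : ℕ) (A B : 𝔸) (z : ℂ) :
    HasDerivAt (linearTerm m A B)
      (A * linearTerm m A B z + B * NormedSpace.exp (z • A) + linearResidual m A B z) z := by
  have hhalf (s : ℂ) : (s / 2) • A = s • ((1 / 2 : ℂ) • A) := by
    rw [smul_smul, mul_one_div]
  have he : HasDerivAt (fun s : ℂ => NormedSpace.exp ((s / 2) • A))
      ((1 / 2 : ℂ) • A * NormedSpace.exp ((z / 2) • A)) z := by
    have := hasDerivAt_exp_smul_const' ((1 / 2 : ℂ) • A) z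
    simpa only [← hhalf] using this
  have hE := hasDerivAt_exp_smul_const' A z
  have hc := hasDerivAt_corrector m A B z
  have h := (((hasDerivAt_id z).smul ((he.mul_const B).mul he)).add (hc.mul hE)).sub (hE.mul hc)
  refine h.congr_deriv ?_
  have hcomm : Commute A (NormedSpace.exp ((z / 2) • A)) :=
    ((Commute.refl A).smul_right _).exp_right
  have hcomm' : Commute A (NormedSpace.exp (z • A)) :=
    ((Commute.refl A).smul_right _).exp_right
  simp only [linearTerm, linearResidual, id, one_smul, Pi.mul_apply]
  generalize NormedSpace.exp ((z / 2) • A) = e at *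
  generalize NormedSpace.exp (z • A) = E at *
  generalize corrector m A B 1 z = c at *
  generalize correctorDeriv m A B z = c' at *
  have h1 : e * (A * B - B * A) * e = A * (e * B * e) - e * B * (A * e) := by
    rw [mul_sub, sub_mul]
    simp only [← mul_assoc]
    rw [hcomm.eq]
  rw [h1]
  simp only [smul_mul_assoc, mul_smul_comm, mul_add, mul_sub, sub_mul, smul_add, smul_sub, smul_smul,
    mul_assoc]
  match_scalars <;> ring

open Polynomial in
-- Through `e^(z ad_A)(X) e^(zA) = e^(zA) X` and its half-step version, every term becomes a
-- function of `z ad_A` applied to `B`, times `e^(zA)`.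
lemma linearResidual_eq (m : ℕ) (A B : 𝔸) (z : ℂ) : linearResidual m A B z =
    (NormedSpace.exp ((1 / 2 : ℂ) • z • adL A) * (1 - (1 / 2 : ℂ) • z • adL A)
      - aeval (z • adL A) (bernoulliPoly m)
      - (NormedSpace.exp (z • adL A) - 1) * aeval (z • adL A) (derivative (bernoulliPoly m))) B
      * NormedSpace.exp (z • A) := by
  have hE (X : 𝔸) : NormedSpace.exp (z • adL A) X * NormedSpace.exp (z • A) =
      NormedSpace.exp (z • A) * X := by
    rw [← adL_smul, exp_adL_apply_mul_exp]
  have he (X : 𝔸) : NormedSpace.exp ((1 / 2 : ℂ) • z • adL A) X * NormedSpace.exp (z • A) =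
      NormedSpace.exp ((z / 2) • A) * X * NormedSpace.exp ((z / 2) • A) := by
    rw [smul_smul, one_div_mul_eq_div, ← adL_smul, ← exp_half_mul_exp_half, ← mul_assoc,
      exp_adL_apply_mul_exp]
  simp only [_root_.sub_apply, mul_apply_eq_comp, one_apply_eq_self, aeval_bernoulliPoly_apply,
    aeval_derivative_bernoulliPoly_apply, sub_mul, hE, he, _root_.smul_apply]
  simp only [smul_smul, add_mul, sub_mul, linearResidual, adL_apply, mul_sub, smul_sub,
    mul_smul_comm, smul_mul_assoc, one_div_mul_eq_div]
  abel

end FirstOrderInPerturbation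

end

end CorrectedPF

namespace CorrectedPF

open Asymptotics Filter Topology

noncomputable section

/-! ### Error up to second order in the perturbation -/

section Perturbation

variable {𝔸 : Type*} [NormedRing 𝔸] [NormOneClass 𝔸] [NormedAlgebra ℂ 𝔸] [CompleteSpace 𝔸]

/-- A bound for the linear term on the disc of radius `2`. -/
def linearBound (m : ℕ) (M : ℝ) : ℝ :=
  2 * (Real.exp M * M * Real.exp M) + 2 * (correctorBound m M * Real.exp (2 * M))

lemma norm_linearTerm_le (m : ℕ) {A B : 𝔸} {M : ℝ} (hA : ‖A‖ ≤ M) (hB : ‖B‖ ≤ M) {z : ℂ}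
    (hz : ‖z‖ ≤ 2) : ‖linearTerm m A B z‖ ≤ linearBound m M := by
  have hc := norm_corrector_le m hA hB hz
  have hE := norm_exp_le_of_le (norm_smul_le_two_mul hA hz)
  have he := norm_exp_half_smul_le hA hz
  have hc0 := (norm_nonneg _).trans hc
  have h1 : ‖z • (NormedSpace.exp ((z / 2) • A) * B * NormedSpace.exp ((z / 2) • A))‖ ≤
      2 * (Real.exp M * M * Real.exp M) :=
    norm_smul_le_two_mul ((norm_mul_le _ _).trans (mul_le_mul ((norm_mul_le _ _).trans
      (mul_le_mul he hB (norm_nonneg _) (by positivity))) he (norm_nonneg _)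
        (mul_nonneg (by positivity) ((norm_nonneg _).trans hB)))) hz
  have h2 := (norm_mul_le (corrector m A B 1 z) (NormedSpace.exp (z • A))).trans
    (mul_le_mul hc hE (norm_nonneg _) hc0)
  have h3 := (norm_mul_le (NormedSpace.exp (z • A)) (corrector m A B 1 z)).trans
    (mul_le_mul hE hc (norm_nonneg _) (by positivity))
  refine (norm_sub_le _ _).trans ((add_le_add ((norm_add_le _ _).trans (add_le_add h1 h2))
    h3).trans_eq ?_)
  rw [linearBound]
  ring

lemma exists_norm_linearResidual_le (m : ℕ) (M : ℝ) : ∃ K : ℝ, 0 ≤ K ∧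
    ∀ (𝔸 : Type*) [NormedRing 𝔸] [NormOneClass 𝔸] [NormedAlgebra ℂ 𝔸] [CompleteSpace 𝔸] (A B : 𝔸),
      ‖A‖ ≤ M → ‖B‖ ≤ M → ∀ z : ℂ, ‖z‖ ≤ 1 →
        ‖linearResidual m A B z‖ ≤ K * ‖z‖ ^ (2 * m + 2) := by
  obtain ⟨K, hK0, hK⟩ := exists_norm_residual_le m (2 * |M|)
  refine ⟨K * (2 * |M|) ^ (2 * m + 2) * |M| * Real.exp (2 * |M|), by positivity, ?_⟩
  intro 𝔸 _ _ _ _ A B hA hB z hz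
  replace hA := hA.trans (le_abs_self M)
  replace hB := hB.trans (le_abs_self M)
  have : Nontrivial 𝔸 := NormOneClass.nontrivial
  have hx := norm_smul_adL_le hA z
  -- The residual estimate is used in the algebra of bounded operators on `𝔸`, where `‖ad_A‖ ≤
  -- 2|M|`.
  have hG := hK (𝔸 →L[ℂ] 𝔸) (z • adL A)
    (hx.trans (mul_le_of_le_one_right (by positivity) hz))
  have hE := norm_exp_le_of_le (norm_smul_le_two_mul hA (hz.trans one_le_two))
  rw [linearResidual_eq]
  calc _ ≤ (K * (2 * |M| * ‖z‖) ^ (2 * m + 2)) * |M| * Real.exp (2 * |M|) := by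
        refine (norm_mul_le _ _).trans ?_
        refine mul_le_mul ?_ hE (norm_nonneg _) (by positivity)
        refine (ContinuousLinearMap.le_opNorm _ _).trans ?_
        refine mul_le_mul (hG.trans ?_) hB (norm_nonneg _) (by positivity)
        gcongr
    _ = _ := by ring

/-- First-order perturbation expansion of the exponential. -/
lemma exists_norm_exp_sub_linear_le (m : ℕ) (M : ℝ) : ∃ K : ℝ, 0 ≤ K ∧
    ∀ (𝔸 : Type*) [NormedRing 𝔸] [NormOneClass 𝔸] [NormedAlgebra ℂ 𝔸] [CompleteSpace 𝔸] (A B : 𝔸),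
      ‖A‖ ≤ M → ‖B‖ ≤ M → ∀ t z : ℂ, ‖t‖ ≤ 1 → ‖z‖ ≤ 1 →
        ‖NormedSpace.exp (z • A) + t • linearTerm m A B z - NormedSpace.exp (z • (A + t • B))‖
          ≤ K * (‖t‖ * ‖z‖ ^ (2 * m + 3) + ‖t‖ ^ 2) := by
  obtain ⟨K, hK0, hK⟩ := exists_norm_linearResidual_le m M
  refine ⟨Real.exp (4 * M) * Real.exp (4 * M) * (K + |M| * |linearBound m M|), by positivity, ?_⟩
  intro 𝔸 _ _ _ _ A B hA hB t z ht hz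
  have htB : ‖t • B‖ ≤ M := by
    rw [norm_smul]
    exact (mul_le_of_le_one_left (norm_nonneg _) ht).trans hB
  let H : 𝔸 := A + t • B
  let W : ℂ → 𝔸 := fun s => NormedSpace.exp (s • A) + t • linearTerm m A B s
  -- Variation of constants: `Z` would be constant if `W` were the exact flow, so its derivative
  -- contains only the residual and the `t ^ 2` term.
  let Z : ℂ → 𝔸 := fun s => NormedSpace.exp (s • -H) * W s
  have hW (s : ℂ) : HasDerivAt W (H * W s + t • linearResidual m A B s
      - t ^ 2 • (B * linearTerm m A B s)) s := by
    refine ((hasDerivAt_exp_smul_const' A s).add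
      ((hasDerivAt_linearTerm m A B s).const_smul t)).congr_deriv ?_
    simp only [W, H, add_mul, mul_add, smul_add, smul_mul_assoc, mul_smul_comm, smul_smul, pow_two]
    abel
  have hZ (s : ℂ) : HasDerivAt Z (NormedSpace.exp (s • -H) * (t • linearResidual m A B s
      - t ^ 2 • (B * linearTerm m A B s))) s := by
    refine ((hasDerivAt_exp_smul_const (-H) s).mul (hW s)).congr_deriv ?_
    noncomm_ring
  have hZ0 : Z 0 = 1 := by simp [Z, W, linearTerm]
  have hexp (s : ℂ) (hs : ‖s‖ ≤ 1) : ‖NormedSpace.exp (s • H)‖ ≤ Real.exp (4 * M) :=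
    norm_exp_smul_add_le hA htB (hs.trans one_le_two)
  have hder (s : ℂ) (hs : s ∈ Metric.closedBall (0 : ℂ) ‖z‖) :
      ‖NormedSpace.exp (s • -H) * (t • linearResidual m A B s
        - t ^ 2 • (B * linearTerm m A B s))‖ ≤ Real.exp (4 * M) *
          (‖t‖ * (K * ‖z‖ ^ (2 * m + 2)) + ‖t‖ ^ 2 * (|M| * |linearBound m M|)) := by
    rw [mem_closedBall_zero_iff] at hs
    have hs1 := hs.trans hz
    refine (norm_mul_le _ _).trans (mul_le_mul ?_ ?_ (norm_nonneg _) (Real.exp_pos _).le)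
    · rw [smul_neg, ← neg_smul]
      exact hexp (-s) (by rwa [norm_neg])
    · refine (norm_sub_le _ _).trans (add_le_add ?_ ?_)
      · rw [norm_smul]
        gcongr
        refine (hK 𝔸 A B hA hB s hs1).trans ?_
        gcongr
      · rw [norm_smul, norm_pow]
        gcongr
        refine (norm_mul_le _ _).trans ?_
        gcongr
        · exact hB.trans (le_abs_self M)
        · exact (norm_linearTerm_le m hA hB (hs1.trans one_le_two)).trans (le_abs_self _)
  have hmv := (convex_closedBall (0 : ℂ) ‖z‖).norm_image_sub_le_of_norm_hasDerivWithin_le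
    (fun s _ => (hZ s).hasDerivWithinAt) hder (x := 0) (y := z) (by simp) (by simp)
  rw [hZ0, sub_zero] at hmv
  have hfac : W z - NormedSpace.exp (z • H) = NormedSpace.exp (z • H) * (Z z - 1) := by
    rw [mul_sub, mul_one, ← mul_assoc, smul_neg, exp_mul_exp_neg, one_mul]
  calc ‖W z - NormedSpace.exp (z • H)‖
      ≤ Real.exp (4 * M) * (Real.exp (4 * M) * (‖t‖ * (K * ‖z‖ ^ (2 * m + 2))
          + ‖t‖ ^ 2 * (|M| * |linearBound m M|)) * ‖z‖) := by
        rw [hfac]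
        refine (norm_mul_le _ _).trans ?_
        gcongr
        exact hexp z hz
    _ = Real.exp (4 * M) * Real.exp (4 * M) * (K * (‖t‖ * ‖z‖ ^ (2 * m + 3))
          + |M| * |linearBound m M| * (‖t‖ ^ 2 * ‖z‖)) := by ring
    _ ≤ Real.exp (4 * M) * Real.exp (4 * M) * (K * (‖t‖ * ‖z‖ ^ (2 * m + 3) + ‖t‖ ^ 2)
          + |M| * |linearBound m M| * (‖t‖ * ‖z‖ ^ (2 * m + 3) + ‖t‖ ^ 2)) := by
        gcongr
        · exact le_add_of_nonneg_right (by positivity)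
        · exact (mul_le_of_le_one_right (by positivity) hz).trans
            (le_add_of_nonneg_left (by positivity))
    _ = _ := by ring

/-- First-order perturbation expansion of the corrected second-order formula. -/
lemma norm_cpf2_sub_linear_le (m : ℕ) {A B : 𝔸} {M : ℝ} (hA : ‖A‖ ≤ M) (hB : ‖B‖ ≤ M) {t z : ℂ}
    (ht : ‖t‖ ≤ 1) (hz : ‖z‖ ≤ 1) :
    ‖cpf2 m A (t • B) 1 z - (NormedSpace.exp (z • A) + t • linearTerm m A B z)‖ ≤
      (cpf2Bound m (2 * M) + Real.exp (2 * M) + 2 * linearBound m M) * ‖t‖ ^ 2 := by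
  have hM : 0 ≤ M := (norm_nonneg A).trans hA
  have hz2 := hz.trans one_le_two
  have hd := hasDerivAt_cpf2_param m A B z
  have hlin : HasDerivAt (fun t : ℂ => NormedSpace.exp (z • A) + t • linearTerm m A B z)
      (linearTerm m A B z) 0 := by
    simpa using ((hasDerivAt_id (0 : ℂ)).smul_const (linearTerm m A B z)).const_add
      (NormedSpace.exp (z • A))
  -- Value and derivative at `t = 0` agree. The Schwarz lemma needs bounds for `‖t‖ ≤ 2`, where `‖t
  -- • B‖ ≤ 2 * M`.
  refine norm_le_mul_pow_of_isLittleO (n := 1)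
    (f := fun t : ℂ => cpf2 m A (t • B) 1 z - (NormedSpace.exp (z • A) + t • linearTerm m A B z))
    ((differentiable_cpf2_param m A B z).sub
      ((differentiable_id.smul_const _).const_add _)) (fun s hs => ?_) (by simp [cpf2_zero]) ?_ ht
  · rw [add_assoc]
    refine (norm_sub_le _ _).trans (add_le_add
      (norm_cpf2_le m (hA.trans (by linarith)) (norm_smul_le_two_mul hB hs) hz2)
      ((norm_add_le _ _).trans (add_le_add
        (norm_exp_le_of_le (norm_smul_le_two_mul hA hz2))
        (norm_smul_le_two_mul (norm_linearTerm_le m hA hB hz2) hs))))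
  · have := (hd.sub hlin).isLittleO
    simpa [cpf2_zero] using this

/-- The corrected second-order formula, up to second order in the perturbation. -/
lemma exists_norm_cpf2_sub_exp_le (m : ℕ) (M : ℝ) : ∃ K : ℝ, 0 ≤ K ∧
    ∀ (𝔸 : Type*) [NormedRing 𝔸] [NormOneClass 𝔸] [NormedAlgebra ℂ 𝔸] [CompleteSpace 𝔸] (A B : 𝔸),
      ‖A‖ ≤ M → ‖B‖ ≤ M → ∀ t z : ℂ, ‖t‖ ≤ 1 → ‖z‖ ≤ 1 →
        ‖cpf2 m A (t • B) 1 z - NormedSpace.exp (z • (A + t • B))‖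
          ≤ K * (‖t‖ * ‖z‖ ^ (2 * m + 3) + ‖t‖ ^ 2) := by
  obtain ⟨K, hK0, hK⟩ := exists_norm_exp_sub_linear_le m M
  refine ⟨|cpf2Bound m (2 * M) + Real.exp (2 * M) + 2 * linearBound m M| + K, by positivity, ?_⟩
  intro 𝔸 _ _ _ _ A B hA hB t z ht hz
  rw [← sub_add_sub_cancel _ (NormedSpace.exp (z • A) + t • linearTerm m A B z), add_mul]
  refine (norm_add_le _ _).trans (add_le_add ((norm_cpf2_sub_linear_le m hA hB ht hz).trans ?_)
    (hK 𝔸 A B hA hB t z ht hz))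
  gcongr
  · exact le_abs_self _
  · exact le_add_of_nonneg_left (by positivity)

/-- The corrected formula of arbitrary order, up to second order in the perturbation. -/
lemma exists_norm_cpf_sub_exp_le (m k : ℕ) (M : ℝ) : ∃ K : ℝ, 0 ≤ K ∧
    ∀ (𝔸 : Type*) [NormedRing 𝔸] [NormOneClass 𝔸] [NormedAlgebra ℂ 𝔸] [CompleteSpace 𝔸] (A B : 𝔸),
      ‖A‖ ≤ M → ‖B‖ ≤ M → ∀ t z : ℂ, ‖t‖ ≤ 1 → ‖z‖ ≤ 1 →
        ‖cpf m (k + 1) A (t • B) 1 z - NormedSpace.exp (z • (A + t • B))‖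
          ≤ K * (‖t‖ * ‖z‖ ^ (2 * m + 3) + ‖t‖ ^ 2) := by
  obtain ⟨K, hK0, hK⟩ := exists_norm_cpf2_sub_exp_le m M
  let L : ℝ := max (cpf2Bound m M) (Real.exp (4 * M))
  have hL : 0 ≤ L := le_max_of_le_right (Real.exp_pos _).le
  refine ⟨(∏ i ∈ Finset.range k, 5 * (L ^ 5 ^ i) ^ 4) * K,
    mul_nonneg (Finset.prod_nonneg fun i _ => by positivity) hK0, ?_⟩
  intro 𝔸 _ _ _ _ A B hA hB t z ht hz
  have htB : ‖t • B‖ ≤ M := by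
    rw [norm_smul]
    exact (mul_le_of_le_one_left (norm_nonneg _) ht).trans hB
  rw [mul_assoc, ← suzuki_exp (A + t • B) k z]
  -- The radius `‖z‖` bounds the basic error at every intermediate argument by its estimate at `z`,
  -- preserving the power of `‖z‖`.
  refine norm_suzuki_sub_le (r := ‖z‖) (fun s hs => ?_) (fun s hs => ?_) (fun s hs => ?_) k le_rfl
  · exact (norm_cpf2_le m hA htB ((hs.trans hz).trans one_le_two)).trans (le_max_left _ _)
  · exact (norm_exp_smul_add_le hA htB ((hs.trans hz).trans one_le_two)).trans (le_max_right _ _)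
  · refine (hK 𝔸 A B hA hB t s ht (hs.trans hz)).trans ?_
    gcongr

end Perturbation

/-! ### Order in `z`, with uniform constants -/

section Order

/-- Error bound for Suzuki's recursion applied to a symmetric second-order formula. -/
lemma norm_suzuki_sub_exp_le {𝔸 : Type*} [NormedRing 𝔸] [NormedAlgebra ℂ 𝔸] [CompleteSpace 𝔸]
    {S : ℂ → 𝔸} {H : 𝔸} {L L' : ℝ} (hS : Differentiable ℂ S) (hsymm : ∀ z, S z * S (-z) = 1)
    (h : (fun z => S z - NormedSpace.exp (z • H)) =O[𝓝 0] fun z : ℂ => z ^ 2)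
    (hL : ∀ z : ℂ, ‖z‖ ≤ 2 → ‖S z‖ ≤ L) (hL' : ∀ z : ℂ, ‖z‖ ≤ 2 → ‖NormedSpace.exp (z • H)‖ ≤ L')
    (k : ℕ) {z : ℂ} (hz : ‖z‖ ≤ 1) :
    ‖suzuki S (k + 1) z - NormedSpace.exp (z • H)‖ ≤ (L ^ 5 ^ k + L') * ‖z‖ ^ (2 * k + 3) := by
  have hO := suzuki_sub_exp_isBigO hS hsymm h k
  refine norm_le_mul_pow_of_isLittleO (n := 2 * k + 2)
    (f := fun z => suzuki S (k + 1) z - NormedSpace.exp (z • H))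
    ((differentiable_suzuki hS k).sub (differentiable_exp.comp (differentiable_id.smul_const H)))
    (fun s hs => (norm_sub_le _ _).trans (add_le_add (norm_suzuki_le hL k hs) (hL' s hs))) ?_
    (hO.trans_isLittleO (isLittleO_pow_pow (Nat.lt_succ_self _))) hz
  obtain ⟨C, hC⟩ := hO.bound
  simpa using hC.self_of_nhds

variable {𝔸 : Type*} [NormedRing 𝔸] [NormOneClass 𝔸] [NormedAlgebra ℂ 𝔸] [CompleteSpace 𝔸]

lemma norm_pf_sub_exp_le (k : ℕ) {A B : 𝔸} {M : ℝ} (hA : ‖A‖ ≤ M) (hB : ‖B‖ ≤ M) {z : ℂ}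
    (hz : ‖z‖ ≤ 1) : ‖pf (k + 1) A B 1 z - NormedSpace.exp (z • (A + B))‖ ≤
      (Real.exp (4 * M) ^ 5 ^ k + Real.exp (4 * M)) * ‖z‖ ^ (2 * k + 3) :=
  norm_suzuki_sub_exp_le (differentiable_pf2 A B) (pf2_mul_pf2_neg A B)
    (hasLeadingError_pf2 A B).sub_exp_isBigO (fun _ hs => norm_pf2_le hA hB hs)
    (fun _ hs => norm_exp_smul_add_le hA hB hs) k hz

lemma norm_cpf_sub_exp_le (m k : ℕ) {A B : 𝔸} {M : ℝ} (hA : ‖A‖ ≤ M) (hB : ‖B‖ ≤ M) {z : ℂ}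
    (hz : ‖z‖ ≤ 1) : ‖cpf m (k + 1) A B 1 z - NormedSpace.exp (z • (A + B))‖ ≤
      (cpf2Bound m M ^ 5 ^ k + Real.exp (4 * M)) * ‖z‖ ^ (2 * k + 3) :=
  norm_suzuki_sub_exp_le (differentiable_cpf2 m A B) (cpf2_mul_cpf2_neg m A B)
    (hasLeadingError_cpf2 m A B).sub_exp_isBigO (fun _ hs => norm_cpf2_le m hA hB hs)
    (fun _ hs => norm_exp_smul_add_le hA hB hs) k hz

end Order

/-! ### Combining the two estimates -/

section Combination

/-- An entire function which is globally of size `δ` and linearly of size `ε`. -/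
lemma norm_le_of_linear_le {E : Type*} [NormedAddCommGroup E] [NormedSpace ℂ E] {f : ℂ → E}
    (hf : Differentiable ℂ f) {K δ ε : ℝ} (hδ : ∀ t, ‖t‖ ≤ 2 → ‖f t‖ ≤ δ)
    (hε : ∀ t, ‖t‖ ≤ 1 → ‖f t‖ ≤ K * (‖t‖ * ε + ‖t‖ ^ 2)) {t : ℂ} (ht : ‖t‖ ≤ 1) :
    ‖f t‖ ≤ K * ε * ‖t‖ + (δ + 2 * (K * ε)) * ‖t‖ ^ 2 := by
  have h0 : f 0 = 0 := by simpa using hε 0 (by simp)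
  have hd : ‖deriv f 0‖ ≤ K * ε := by
    have hlim : Tendsto (fun s : ℂ => K * (ε + ‖s‖)) (𝓝[≠] 0) (𝓝 (K * ε)) := by
      refine Tendsto.mono_left ?_ nhdsWithin_le_nhds
      exact Continuous.tendsto' (by fun_prop) _ _ (by simp)
    have hslope := (hasDerivAt_iff_tendsto_slope.1 (hf 0).hasDerivAt).norm
    -- Dividing `hε` by `‖s‖` and letting `s → 0` removes the quadratic term.
    refine le_of_tendsto_of_tendsto hslope hlim ?_
    filter_upwards [self_mem_nhdsWithin,
      nhdsWithin_le_nhds (Metric.closedBall_mem_nhds (0 : ℂ) one_pos)] with s hs0 hs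
    have hs1 := hε s (mem_closedBall_zero_iff.1 hs)
    have hpos : 0 < ‖s‖ := norm_pos_iff.2 hs0
    rw [slope_def_module, h0, sub_zero, sub_zero, norm_smul, norm_inv, inv_mul_le_iff₀ hpos]
    exact hs1.trans_eq (by ring)
  have hrem : ‖f t - t • deriv f 0‖ ≤ (δ + 2 * (K * ε)) * ‖t‖ ^ 2 := by
    refine norm_le_mul_pow_of_isLittleO (n := 1) (f := fun t => f t - t • deriv f 0)
      (hf.sub (differentiable_id.smul_const _)) (fun s hs => ?_) (by simp [h0]) ?_ ht
    · refine (norm_sub_le _ _).trans (add_le_add (hδ s hs) ?_)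
      rw [norm_smul]
      exact mul_le_mul hs hd (norm_nonneg _) zero_le_two
    · simpa [h0] using (hf 0).hasDerivAt.isLittleO
  calc ‖f t‖ = ‖t • deriv f 0 + (f t - t • deriv f 0)‖ := by rw [add_sub_cancel]
    _ ≤ ‖t‖ * ‖deriv f 0‖ + (δ + 2 * (K * ε)) * ‖t‖ ^ 2 :=
        (norm_add_le _ _).trans (add_le_add (norm_smul _ _).le hrem)
    _ ≤ _ := by
        rw [mul_comm (K * ε)]
        gcongr

lemma differentiable_exp_param {𝔸 : Type*} [NormedRing 𝔸] [NormedAlgebra ℂ 𝔸] [CompleteSpace 𝔸]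
    (A B : 𝔸) (z : ℂ) : Differentiable ℂ fun t : ℂ => NormedSpace.exp (z • (A + t • B)) :=
  differentiable_exp.comp (((differentiable_id.smul_const B).const_add A).const_smul z)

/-- The error of the corrected formula. -/
lemma exists_norm_exp_sub_cpf_le (m k : ℕ) (hkm : k + 1 ≤ m) (M : ℝ) : ∃ K : ℝ, 0 ≤ K ∧
    ∀ (𝔸 : Type*) [NormedRing 𝔸] [NormOneClass 𝔸] [NormedAlgebra ℂ 𝔸] [CompleteSpace 𝔸] (A B : 𝔸),
      ‖A‖ ≤ M → ‖B‖ ≤ M → ∀ (α : ℝ) (z : ℂ), 0 < α → α ≤ 1 → ‖z‖ ≤ 1 →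
        ‖NormedSpace.exp (z • (A + (α : ℂ) • B)) - cpf m (k + 1) A B α z‖
          ≤ K * (α ^ 2 * ‖z‖ ^ (2 * (k + 1) + 1) + α * ‖z‖ ^ (2 * m + 3)) := by
  obtain ⟨K, hK0, hK⟩ := exists_norm_cpf_sub_exp_le m k M
  let K' : ℝ := cpf2Bound m (2 * M) ^ 5 ^ k + Real.exp (4 * (2 * M))
  have hK' : 0 ≤ K' := by simp only [K', cpf2Bound]; positivity
  refine ⟨K' + 2 * K + K, by positivity, ?_⟩
  intro 𝔸 _ _ _ _ A B hA hB α z hα hα1 hz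
  have hM : 0 ≤ M := (norm_nonneg A).trans hA
  have hαn : ‖(α : ℂ)‖ = α := by rw [Complex.norm_real, Real.norm_of_nonneg hα.le]
  have hmain := norm_le_of_linear_le
    (f := fun t : ℂ => cpf m (k + 1) A (t • B) 1 z - NormedSpace.exp (z • (A + t • B)))
    ((differentiable_suzuki_param (differentiable_cpf2_param m A B) k z).sub
      (differentiable_exp_param A B z)) (δ := K' * ‖z‖ ^ (2 * k + 3))
    (fun t ht => norm_cpf_sub_exp_le m k (hA.trans (by linarith)) (norm_smul_le_two_mul hB ht) hz)
    (fun t ht => hK 𝔸 A B hA hB t z ht hz) (t := (α : ℂ)) (by rwa [hαn])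
  rw [hαn] at hmain
  have hpow : ‖z‖ ^ (2 * m + 3) ≤ ‖z‖ ^ (2 * k + 3) :=
    pow_le_pow_of_le_one (norm_nonneg z) hz (by omega)
  rw [norm_sub_rev, cpf, cpf2_eq]
  refine hmain.trans ?_
  rw [show 2 * (k + 1) + 1 = 2 * k + 3 by ring]
  calc K * ‖z‖ ^ (2 * m + 3) * α + (K' * ‖z‖ ^ (2 * k + 3) + 2 * (K * ‖z‖ ^ (2 * m + 3))) * α ^ 2
      ≤ K * ‖z‖ ^ (2 * m + 3) * α
        + (K' * ‖z‖ ^ (2 * k + 3) + 2 * (K * ‖z‖ ^ (2 * k + 3))) * α ^ 2 := by gcongr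
    _ = (K' + 2 * K) * (α ^ 2 * ‖z‖ ^ (2 * k + 3)) + K * (α * ‖z‖ ^ (2 * m + 3)) := by ring
    _ ≤ (K' + 2 * K) * (α ^ 2 * ‖z‖ ^ (2 * k + 3)) + K * (α * ‖z‖ ^ (2 * m + 3))
        + ((K' + 2 * K) * (α * ‖z‖ ^ (2 * m + 3)) + K * (α ^ 2 * ‖z‖ ^ (2 * k + 3))) :=
        le_add_of_nonneg_right (by positivity)
    _ = _ := by ring

/-- The error of the standard formula. -/
lemma norm_exp_sub_pf_le {𝔸 : Type*} [NormedRing 𝔸] [NormOneClass 𝔸] [NormedAlgebra ℂ 𝔸]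
    [CompleteSpace 𝔸] (k : ℕ) {A B : 𝔸} {M : ℝ} (hA : ‖A‖ ≤ M) (hB : ‖B‖ ≤ M) {α : ℝ} {z : ℂ}
    (hα : 0 < α) (hα1 : α ≤ 1) (hz : ‖z‖ ≤ 1) :
    ‖NormedSpace.exp (z • (A + (α : ℂ) • B)) - pf (k + 1) A B α z‖ ≤
      (Real.exp (4 * (2 * M)) ^ 5 ^ k + Real.exp (4 * (2 * M))) *
        (α * ‖z‖ ^ (2 * (k + 1) + 1)) := by
  have hM : 0 ≤ M := (norm_nonneg A).trans hA
  have hαn : ‖(α : ℂ)‖ = α := by rw [Complex.norm_real, Real.norm_of_nonneg hα.le]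
  let f : ℂ → 𝔸 := fun t => pf (k + 1) A (t • B) 1 z - NormedSpace.exp (z • (A + t • B))
  have hf : Differentiable ℂ f :=
    (differentiable_suzuki_param (differentiable_pf2_param A B) k z).sub
      (differentiable_exp_param A B z)
  have h0 : f 0 = 0 := by
    have : pf2 A (0 : 𝔸) 1 = fun z : ℂ => NormedSpace.exp (z • A) := funext (pf2_zero A)
    simp [f, pf, this, suzuki_exp]
  -- Without a corrector only `f 0 = 0` is available, so the Schwarz lemma yields a single factor of
  -- `α`.
  have hlo : f =o[𝓝 0] fun t : ℂ => t ^ 0 := by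
    simpa only [pow_zero, isLittleO_one_iff, h0] using hf.continuous.tendsto 0
  have hmain := norm_le_mul_pow_of_isLittleO (n := 0) hf
    (fun t ht => norm_pf_sub_exp_le k (hA.trans (by linarith)) (norm_smul_le_two_mul hB ht) hz) h0
    hlo (z := (α : ℂ)) (by rwa [hαn])
  rw [hαn] at hmain
  rw [norm_sub_rev, pf, pf2_eq]
  exact hmain.trans_eq (by ring)

end Combination

end

end CorrectedPF

theorem mainTheorem2 (k m : ℕ) (hk : 1 ≤ k) (hkm : k ≤ m) (M : ℝ) :
    ∃ K : ℝ, ∀ (𝔸 : Type*) [NormedRing 𝔸] [NormOneClass 𝔸] [NormedAlgebra ℂ 𝔸]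
      [CompleteSpace 𝔸] (A B : 𝔸), ‖A‖ ≤ M → ‖B‖ ≤ M →
      ∀ (α : ℝ) (z : ℂ), 0 < α → α ≤ 1 → ‖z‖ ≤ 1 →
        ‖NormedSpace.exp (z • (A + (α : ℂ) • B)) - CorrectedPF.cpf m k A B α z‖
            ≤ K * (α ^ 2 * ‖z‖ ^ (2 * k + 1) + α * ‖z‖ ^ (2 * m + 3)) ∧
        (‖z‖ ^ (2 * (m - k) + 2) ≤ α →
          ‖NormedSpace.exp (z • (A + (α : ℂ) • B)) - CorrectedPF.cpf m k A B α z‖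
            ≤ K * (α ^ 2 * ‖z‖ ^ (2 * k + 1))) ∧
        ‖NormedSpace.exp (z • (A + (α : ℂ) • B)) - CorrectedPF.pf k A B α z‖
            ≤ K * (α * ‖z‖ ^ (2 * k + 1)) := by
  obtain ⟨n, rfl⟩ : ∃ n, k = n + 1 := ⟨k - 1, by omega⟩
  obtain ⟨K, hK0, hK⟩ := CorrectedPF.exists_norm_exp_sub_cpf_le m n hkm M
  refine ⟨2 * K + (Real.exp (4 * (2 * M)) ^ 5 ^ n + Real.exp (4 * (2 * M))), ?_⟩
  have hexp : 0 ≤ Real.exp (4 * (2 * M)) ^ 5 ^ n + Real.exp (4 * (2 * M)) := by positivity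
  intro 𝔸 _ _ _ _ A B hA hB α z hα hα1 hz
  have h1 := hK 𝔸 A B hA hB α z hα hα1 hz
  refine ⟨h1.trans ?_, fun hαz => h1.trans ?_,
    (CorrectedPF.norm_exp_sub_pf_le n hA hB hα hα1 hz).trans ?_⟩
  · gcongr
    linarith
  · have h2 : α * ‖z‖ ^ (2 * m + 3) ≤ α ^ 2 * ‖z‖ ^ (2 * (n + 1) + 1) := by
      -- The first summand is the exponent in the smallness condition, which trades that power of
      -- `‖z‖` for a second factor `α`; the two terms then merge, whence `2 * K`.
      have e : 2 * m + 3 = (2 * (m - (n + 1)) + 2) + (2 * (n + 1) + 1) := by omega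
      rw [e, pow_add, pow_two, mul_assoc α α]
      gcongr
    calc K * (α ^ 2 * ‖z‖ ^ (2 * (n + 1) + 1) + α * ‖z‖ ^ (2 * m + 3))
        ≤ K * (α ^ 2 * ‖z‖ ^ (2 * (n + 1) + 1) + α ^ 2 * ‖z‖ ^ (2 * (n + 1) + 1)) := by gcongr
      _ = 2 * K * (α ^ 2 * ‖z‖ ^ (2 * (n + 1) + 1)) := by ring
      _ ≤ _ := by
        gcongr
        linarith
  · exact mul_le_mul_of_nonneg_right (by linarith) (by positivity)
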